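/- Let $S$ be a directed partially ordered set. For a commutative ring $k$, a pro-non-unital associative $k$-algebra $\{I_m\}_{m\in S}$ is a contravariant functor from $S$ to not necessarily unital associative $k$-algebras, that is, a family of such algebras $I_m$ with compatible $k$-algebra homomorphisms $I_{m'}\to I_m$ for $m'\ge m$. Let $k\ltimes I_m$ denote the associative unital ring with underlying additive group $k\times I_m$ and multiplication $(a,x)\cdot(a',x')=(aa',\,ax'+a'x+xx')$, and regard $k$ as a left and right $(k\ltimes I_m)$-module via the augmentation $(a,x)\mapsto a$. A pro-$k$-module $\{X_m\}_{m\in S}$ (a contravariant functor from $S$ to $k$-modules) is zero if for every $m\in S$ there is $m'\ge m$ such that the structure map $X_{m'}\to X_m$ is zero. Let $\alpha\colon k'\to k$ be a homomorphism of commutative rings, let $\{I_m\}$ be a pro-non-unital associative $k$-algebra, and let $\{I_m^{\alpha}\}$ be $\{I_m\}$ considered as a pro-non-unital associative $k'$-algebra via $\alpha$. Assume that the pro-$k$-module $$\{\operatorname{Tor}_q^{k\ltimes I_m}(k,k)\}$$ (with structure maps induced by the maps $I_{m'}\to I_m$) is zero for all integers $q>0$. Then the pro-$k'$-module $$\{\operatorname{Tor}_q^{k'\ltimes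 I_m^{\alpha}}(k',k')\}$$ is zero for all integers $q>0$. -/

import Mathlib

universe u v

set_option linter.unusedVariables false

open CategoryTheory
open scoped TensorProduct

noncomputable section

namespace ProTor

/-! ### Tensor products over a not necessarily commutative ring -/

section Balanced

variable (R : Type u) [CommRing R]

/-- For an `R`-`A`-bimodule `X` and a left `A`-module `Y`: the `R`-submodule of `X ⊗[ℤ] Y`
generated by the elements `(x · a) ⊗ y - x ⊗ (a · y)`. A right `A`-module structure is a module
structure over the opposite ring, so `MulOpposite.op a • x` is `x · a`. -/
def balancedRel (A : Type u) [Ring A] (X : Type u) [AddCommGroup X] [Module R X]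
    [Module Aᵐᵒᵖ X] [SMulCommClass R Aᵐᵒᵖ X] (Y : Type u) [AddCommGroup Y] [Module A Y] :
    Submodule R (X ⊗[ℤ] Y) :=
  Submodule.span R {t | ∃ (x : X) (a : A) (y : Y),
    t = (MulOpposite.op a • x) ⊗ₜ[ℤ] y - x ⊗ₜ[ℤ] (a • y)}

/-- The tensor product `X ⊗_A Y` of an `R`-`A`-bimodule and a left `A`-module; an `R`-module. -/
abbrev BalancedTensor (A : Type u) [Ring A] (X : Type u) [AddCommGroup X] [Module R X]
    [Module Aᵐᵒᵖ X] [SMulCommClass R Aᵐᵒᵖ X] (Y : Type u) [AddCommGroup Y] [Module A Y] :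
    Type u :=
  (X ⊗[ℤ] Y) ⧸ balancedRel R A X Y

variable {A : Type u} [Ring A] {B : Type u} [Ring B] {C : Type u} [Ring C]
variable {X : Type u} [AddCommGroup X] [Module R X] [Module Aᵐᵒᵖ X] [SMulCommClass R Aᵐᵒᵖ X]
variable {X' : Type u} [AddCommGroup X'] [Module R X'] [Module Bᵐᵒᵖ X'] [SMulCommClass R Bᵐᵒᵖ X']
variable {X'' : Type u} [AddCommGroup X''] [Module R X''] [Module Cᵐᵒᵖ X'']
  [SMulCommClass R Cᵐᵒᵖ X'']
variable {Y : Type u} [AddCommGroup Y] [Module A Y]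
variable {Y' : Type u} [AddCommGroup Y'] [Module B Y']
variable {Y'' : Type u} [AddCommGroup Y''] [Module C Y'']

/-- The map `X ⊗_A Y → X' ⊗_B Y'`, `x ⊗ y ↦ h x ⊗ g y`, induced by a ring homomorphism
`f : A → B`, an `f`-semilinear map `h : X → X'` of right modules (linear over `R`) and an
`f`-semilinear map `g : Y → Y'` of left modules. -/
def balancedMap (f : A →+* B) (h : X →ₗ[R] X')
    (hh : ∀ (a : A) (x : X), h (MulOpposite.op a • x) = MulOpposite.op (f a) • h x)
    (g : Y →ₛₗ[f] Y') : BalancedTensor R A X Y →ₗ[R] BalancedTensor R B X' Y' :=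
  Submodule.mapQ _ _
    (TensorProduct.AlgebraTensorModule.map h g.toAddMonoidHom.toIntLinearMap) <| by
    rw [balancedRel, Submodule.span_le]
    rintro _ ⟨x, a, y, rfl⟩
    refine Submodule.subset_span ⟨h x, f a, g y, ?_⟩
    simp [hh]

variable {R}

@[simp]
theorem balancedMap_mk (f : A →+* B) (h : X →ₗ[R] X')
    (hh : ∀ (a : A) (x : X), h (MulOpposite.op a • x) = MulOpposite.op (f a) • h x)
    (g : Y →ₛₗ[f] Y') (x : X) (y : Y) :
    balancedMap R f h hh g (Submodule.Quotient.mk (x ⊗ₜ[ℤ] y)) =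
      Submodule.Quotient.mk (h x ⊗ₜ[ℤ] g y) := rfl

theorem balanced_ext {Z : Type u} [AddCommGroup Z] [Module R Z]
    {p q : BalancedTensor R A X Y →ₗ[R] Z}
    (hpq : ∀ (x : X) (y : Y), p (Submodule.Quotient.mk (x ⊗ₜ[ℤ] y)) =
      q (Submodule.Quotient.mk (x ⊗ₜ[ℤ] y))) : p = q := by
  refine Submodule.linearMap_qext _ (LinearMap.ext fun t => ?_)
  induction t using TensorProduct.induction_on with
  | zero => simp only [map_zero]
  | tmul x y => exact hpq x y
  | add a b ha hb => simp only [map_add, ha, hb]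

end Balanced

/-- The functor `X ⊗_A -` from left `A`-modules to `R`-modules. -/
def balancedFunctor (R : Type u) [CommRing R] (A : Type u) [Ring A] (X : Type u)
    [AddCommGroup X] [Module R X] [Module Aᵐᵒᵖ X] [SMulCommClass R Aᵐᵒᵖ X] :
    ModuleCat.{u} A ⥤ ModuleCat.{u} R where
  obj Y := ModuleCat.of R (BalancedTensor R A X Y)
  map g := ModuleCat.ofHom
    (balancedMap R (RingHom.id A) (LinearMap.id (R := R) (M := X)) (fun _ _ => rfl) g.hom)
  map_id Y := ModuleCat.hom_ext (balanced_ext fun x y => rfl)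
  map_comp g h := ModuleCat.hom_ext (balanced_ext fun x y => rfl)

instance (R : Type u) [CommRing R] (A : Type u) [Ring A] (X : Type u)
    [AddCommGroup X] [Module R X] [Module Aᵐᵒᵖ X] [SMulCommClass R Aᵐᵒᵖ X] :
    (balancedFunctor R A X).Additive where
  map_add {Y Z g h} := ModuleCat.hom_ext <| balanced_ext fun x y =>
    congrArg Submodule.Quotient.mk (TensorProduct.tmul_add x (g.hom y) (h.hom y))

/-- `Tor_n^A(X, -)`, the `n`-th left derived functor of `X ⊗_A -`. -/
def Tor (R : Type u) [CommRing R] (A : Type u) [Ring A] (X : Type u)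
    [AddCommGroup X] [Module R X] [Module Aᵐᵒᵖ X] [SMulCommClass R Aᵐᵒᵖ X] (n : ℕ) :
    ModuleCat.{u} A ⥤ ModuleCat.{u} R :=
  (balancedFunctor R A X).leftDerived n

/-! ### The standard free resolution

It is natural with respect to semilinear maps, and serves to describe the maps on `Tor` that are
induced by ring homomorphisms. -/

section Resolution

/-- The canonical map `A[M] → M` from the free module on the set underlying `M`. -/
abbrev freeCounit (A : Type u) [Ring A] (M : Type u) [AddCommGroup M] [Module A M] :
    (M →₀ A) →ₗ[A] M :=
  Finsupp.linearCombination A id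

/-- The iterated syzygies `M`, `ker (A[M] → M)`, … of `M`. -/
def syz (A : Type u) [Ring A] (M : ModuleCat.{u} A) : ℕ → ModuleCat.{u} A
  | 0 => M
  | n + 1 => ModuleCat.of A (LinearMap.ker (freeCounit A (syz A M n)))

/-- The differential `A[syz (n + 1)] → syz (n + 1) ⊆ A[syz n]`. -/
def stdD (A : Type u) [Ring A] (M : ModuleCat.{u} A) (n : ℕ) :
    (syz A M (n + 1) →₀ A) →ₗ[A] (syz A M n →₀ A) :=
  (LinearMap.ker (freeCounit A (syz A M n))).subtype ∘ₗ freeCounit A (syz A M (n + 1))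

theorem freeCounit_surjective (A : Type u) [Ring A] (M : Type u) [AddCommGroup M] [Module A M] :
    Function.Surjective (freeCounit A M) := fun m =>
  ⟨Finsupp.single m 1, by simp⟩

theorem freeCounit_stdD (A : Type u) [Ring A] (M : ModuleCat.{u} A) (n : ℕ)
    (v : syz A M (n + 1) →₀ A) : freeCounit A (syz A M n) (stdD A M n v) = 0 :=
  (freeCounit A (syz A M (n + 1)) v).2

theorem stdD_eq_zero_iff (A : Type u) [Ring A] (M : ModuleCat.{u} A) (n : ℕ)
    (v : syz A M (n + 1) →₀ A) : stdD A M n v = 0 ↔ freeCounit A (syz A M (n + 1)) v = 0 :=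
  Submodule.coe_eq_zero

theorem exact_freeCounit (A : Type u) [Ring A] (M : ModuleCat.{u} A) (n : ℕ)
    (v : syz A M n →₀ A) (hv : freeCounit A (syz A M n) v = 0) : ∃ w, stdD A M n w = v := by
  obtain ⟨w, hw⟩ := freeCounit_surjective A (syz A M (n + 1)) ⟨v, hv⟩
  exact ⟨w, congrArg Subtype.val hw⟩

/-- The standard free resolution `… → A[syz 1] → A[syz 0]` of `M`, as a chain complex. -/
def stdComplex (A : Type u) [Ring A] (M : ModuleCat.{u} A) : ChainComplex (ModuleCat.{u} A) ℕ :=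
  ChainComplex.of (fun n => ModuleCat.of A (syz A M n →₀ A)) (fun n => ModuleCat.ofHom (stdD A M n))
    (fun n => ModuleCat.hom_ext <| LinearMap.ext fun v =>
      (stdD_eq_zero_iff A M n _).2 (freeCounit_stdD A M (n + 1) v))

theorem stdComplex_d (A : Type u) [Ring A] (M : ModuleCat.{u} A) (n : ℕ) :
    (stdComplex A M).d (n + 1) n = ModuleCat.ofHom (stdD A M n) :=
  ChainComplex.of_d (V := ModuleCat.{u} A) (X := fun n => ModuleCat.of A (syz A M n →₀ A))
    (d := fun n => ModuleCat.ofHom (stdD A M n)) ..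

instance (A : Type u) [Ring A] (M : ModuleCat.{u} A) (n : ℕ) :
    Projective ((stdComplex A M).X n) :=
  (IsProjective.iff_projective (R := A) (syz A M n →₀ A)).1 inferInstance

/-- The standard free resolution of `M`, as a projective resolution. -/
def stdRes (A : Type u) [Ring A] (M : ModuleCat.{u} A) : ProjectiveResolution M where
  complex := stdComplex A M
  π := (ChainComplex.toSingle₀Equiv _ _).symm
    ⟨ModuleCat.ofHom (freeCounit A M), by
      rw [stdComplex_d]
      exact ModuleCat.hom_ext (LinearMap.ext fun v => freeCounit_stdD A M 0 v)⟩
  quasiIso := ⟨fun n => by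
    cases n
    · rw [ChainComplex.quasiIsoAt₀_iff, ShortComplex.quasiIso_iff_of_zeros']
      · refine (ShortComplex.exact_and_epi_g_iff_of_iso (S₂ := ShortComplex.mk
            (ModuleCat.ofHom (stdD A M 0)) (ModuleCat.ofHom (freeCounit A M))
            (ModuleCat.hom_ext (LinearMap.ext fun v => freeCounit_stdD A M 0 v))) ?_).2 ⟨?_, ?_⟩
        · exact ShortComplex.isoMk (Iso.refl _) (Iso.refl _) (Iso.refl _)
            ((Category.id_comp _).trans ((stdComplex_d A M 0).symm.trans (Category.comp_id _).symm))
            ((Category.id_comp _).trans (Category.comp_id _).symm)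
        · exact (ShortComplex.moduleCat_exact_iff _).2 fun v hv => exact_freeCounit A M 0 v hv
        · exact (ModuleCat.epi_iff_surjective _).2 (freeCounit_surjective A M)
      all_goals rfl
    · rw [quasiIsoAt_iff_exactAt']
      · rename_i n
        rw [HomologicalComplex.exactAt_iff' _ (n + 1 + 1) (n + 1) n (by simp) (by simp),
          ShortComplex.moduleCat_exact_iff]
        intro v hv
        have hv' : stdD A M n v = 0 := by
          have h := stdComplex_d A M n
          exact (congrArg (fun φ => φ.hom v) h).symm.trans hv
        obtain ⟨w, hw⟩ := exact_freeCounit A M (n + 1) v ((stdD_eq_zero_iff A M n v).1 hv')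
        refine ⟨w, ?_⟩
        have h := stdComplex_d A M (n + 1)
        exact (congrArg (fun φ => φ.hom w) h).trans hw
      · apply ChainComplex.exactAt_succ_single_obj⟩

variable {A : Type u} [Ring A] {B : Type u} [Ring B] {C : Type u} [Ring C]
variable {M : ModuleCat.{u} A} {N : ModuleCat.{u} B} {P : ModuleCat.{u} C}

/-- The semilinear map `A[M] → B[N]`, `a · [m] ↦ f a · [g m]`, of free modules. -/
def freeMap (f : A →+* B) {M N : Type u} (g : M → N) : (M →₀ A) →ₛₗ[f] (N →₀ B) where
  toFun v := (v.mapRange f f.map_zero).mapDomain g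
  map_add' v w := by rw [Finsupp.mapRange_add f.map_add, Finsupp.mapDomain_add]
  map_smul' a v := by
    rw [← Finsupp.mapDomain_smul]
    congr 1
    ext m
    simp

@[simp]
theorem freeMap_single (f : A →+* B) {M N : Type u} (g : M → N) (m : M) (a : A) :
    freeMap f g (Finsupp.single m a) = Finsupp.single (g m) (f a) := by
  simp [freeMap]

theorem freeCounit_freeMap (f : A →+* B) {M N : Type u} [AddCommGroup M] [Module A M]
    [AddCommGroup N] [Module B N] (g : M →ₛₗ[f] N) (v : M →₀ A) :
    freeCounit B N (freeMap f g v) = g (freeCounit A M v) := by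
  induction v using Finsupp.induction_linear with
  | zero => simp only [map_zero]
  | add v w hv hw => simp only [map_add, hv, hw]
  | single m a => simp

/-- The semilinear map on iterated syzygies that is induced by a semilinear map. -/
def syzMap (f : A →+* B) (g : M →ₛₗ[f] N) : ∀ n, syz A M n →ₛₗ[f] syz B N n
  | 0 => g
  | n + 1 => (freeMap f (syzMap f g n)).restrict
      (p := LinearMap.ker (freeCounit A (syz A M n)))
      (q := LinearMap.ker (freeCounit B (syz B N n))) fun v hv => by
        rw [LinearMap.mem_ker] at hv ⊢
        rw [freeCounit_freeMap, hv, map_zero]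

theorem stdD_freeMap (f : A →+* B) (g : M →ₛₗ[f] N) (n : ℕ) (v : syz A M (n + 1) →₀ A) :
    stdD B N n (freeMap f (syzMap f g (n + 1)) v) = freeMap f (syzMap f g n) (stdD A M n v) :=
  congrArg Subtype.val (freeCounit_freeMap f (syzMap f g (n + 1)) v)

theorem freeMap_id {M : Type u} (v : M →₀ A) : freeMap (RingHom.id A) id v = v := by
  simp [freeMap]

theorem freeMap_comp (f : A →+* B) (f' : B →+* C) (f'' : A →+* C) {M N P : Type u} (g : M → N)
    (g' : N → P) (g'' : M → P) (hf : ∀ a, f'' a = f' (f a)) (hg : ∀ m, g'' m = g' (g m))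
    (v : M →₀ A) : freeMap f'' g'' v = freeMap f' g' (freeMap f g v) := by
  induction v using Finsupp.induction_linear with
  | zero => simp only [map_zero]
  | add v w hv hw => simp only [map_add, hv, hw]
  | single m a => simp [hf, hg]

theorem syzMap_id (f : A →+* A) (g : M →ₛₗ[f] M) (hf : ∀ a, f a = a) (hg : ∀ m, g m = m) :
    ∀ (n : ℕ) (x : syz A M n), syzMap f g n x = x
  | 0, x => hg x
  | n + 1, x => Subtype.ext <| by
      obtain rfl : f = RingHom.id A := RingHom.ext hf
      exact (congrArg (fun φ => freeMap (RingHom.id A) φ x.1)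
        (funext (syzMap_id _ g hf hg n))).trans (freeMap_id x.1)

theorem syzMap_comp (f : A →+* B) (f' : B →+* C) (f'' : A →+* C) (g : M →ₛₗ[f] N)
    (g' : N →ₛₗ[f'] P) (g'' : M →ₛₗ[f''] P) (hf : ∀ a, f'' a = f' (f a))
    (hg : ∀ m, g'' m = g' (g m)) :
    ∀ (n : ℕ) (x : syz A M n), syzMap f'' g'' n x = syzMap f' g' n (syzMap f g n x)
  | 0, x => hg x
  | n + 1, x => Subtype.ext <|
      freeMap_comp f f' f'' _ _ _ hf (syzMap_comp f f' f'' g g' g'' hf hg n) x.1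

end Resolution

/-! ### Maps on `Tor` induced by change of rings -/

section TorMap

variable {R : Type u} [CommRing R]
variable {A : Type u} [Ring A] {B : Type u} [Ring B] {C : Type u} [Ring C]
variable {X : Type u} [AddCommGroup X] [Module R X] [Module Aᵐᵒᵖ X] [SMulCommClass R Aᵐᵒᵖ X]
variable {X' : Type u} [AddCommGroup X'] [Module R X'] [Module Bᵐᵒᵖ X'] [SMulCommClass R Bᵐᵒᵖ X']
variable {X'' : Type u} [AddCommGroup X''] [Module R X''] [Module Cᵐᵒᵖ X'']
  [SMulCommClass R Cᵐᵒᵖ X'']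
variable {M : ModuleCat.{u} A} {N : ModuleCat.{u} B} {P : ModuleCat.{u} C}

/-- The complex `X ⊗_A F`, where `F` is the standard free resolution of `M`. -/
abbrev torComplex (R : Type u) [CommRing R] (A : Type u) [Ring A] (X : Type u)
    [AddCommGroup X] [Module R X] [Module Aᵐᵒᵖ X] [SMulCommClass R Aᵐᵒᵖ X]
    (M : ModuleCat.{u} A) : ChainComplex (ModuleCat.{u} R) ℕ :=
  ((balancedFunctor R A X).mapHomologicalComplex _).obj (stdComplex A M)

theorem torComplex_d (R : Type u) [CommRing R] (A : Type u) [Ring A] (X : Type u)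
    [AddCommGroup X] [Module R X] [Module Aᵐᵒᵖ X] [SMulCommClass R Aᵐᵒᵖ X]
    (M : ModuleCat.{u} A) (n : ℕ) :
    (torComplex R A X M).d (n + 1) n =
      (balancedFunctor R A X).map (ModuleCat.ofHom (stdD A M n)) :=
  congrArg (balancedFunctor R A X).map (stdComplex_d A M n)

/-- `Tor_n^A(X, M)` is the homology of `X ⊗_A F`, where `F` is the standard free resolution. -/
def torIso (R : Type u) [CommRing R] (A : Type u) [Ring A] (X : Type u)
    [AddCommGroup X] [Module R X] [Module Aᵐᵒᵖ X] [SMulCommClass R Aᵐᵒᵖ X]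
    (M : ModuleCat.{u} A) (n : ℕ) :
    (Tor R A X n).obj M ≅ (torComplex R A X M).homology n :=
  (stdRes A M).isoLeftDerivedObj (balancedFunctor R A X) n

/-- The chain map `X ⊗_A F → X' ⊗_B G`, where `F → G` is the semilinear map of standard free
resolutions that lifts the semilinear map `g : M → N`. -/
def torComplexMap (f : A →+* B) (h : X →ₗ[R] X')
    (hh : ∀ (a : A) (x : X), h (MulOpposite.op a • x) = MulOpposite.op (f a) • h x)
    (g : M →ₛₗ[f] N) : torComplex R A X M ⟶ torComplex R B X' N where
  f n := ModuleCat.ofHom (balancedMap R f h hh (freeMap f (syzMap f g n)))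
  comm' i j hij := by
    obtain rfl : j + 1 = i := hij
    rw [torComplex_d, torComplex_d]
    exact ModuleCat.hom_ext <| balanced_ext fun x v =>
      congrArg (fun w => Submodule.Quotient.mk (h x ⊗ₜ[ℤ] w)) (stdD_freeMap f g j v)

/-- The map `Tor_n^A(X, M) → Tor_n^B(X', N)` that is induced by a ring homomorphism `f : A → B`
and `f`-semilinear maps `h : X → X'` and `g : M → N`. -/
def torMap (f : A →+* B) (h : X →ₗ[R] X')
    (hh : ∀ (a : A) (x : X), h (MulOpposite.op a • x) = MulOpposite.op (f a) • h x)
    (g : M →ₛₗ[f] N) (n : ℕ) : (Tor R A X n).obj M ⟶ (Tor R B X' n).obj N :=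
  (torIso R A X M n).hom ≫ HomologicalComplex.homologyMap (torComplexMap f h hh g) n ≫
    (torIso R B X' N n).inv

theorem torMap_id (f : A →+* A) (h : X →ₗ[R] X)
    (hh : ∀ (a : A) (x : X), h (MulOpposite.op a • x) = MulOpposite.op (f a) • h x)
    (g : M →ₛₗ[f] M) (n : ℕ) (hf : ∀ a, f a = a) (hx : ∀ x, h x = x) (hg : ∀ m, g m = m) :
    torMap f h hh g n = 𝟙 _ := by
  have key : torComplexMap f h hh g = 𝟙 _ := by
    refine HomologicalComplex.Hom.ext (funext fun i => ModuleCat.hom_ext ?_)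
    refine balanced_ext fun x v => congrArg Submodule.Quotient.mk ?_
    obtain rfl : f = RingHom.id A := RingHom.ext hf
    exact congrArg₂ (fun x w => x ⊗ₜ[ℤ] w) (hx x)
      ((congrArg (fun φ => freeMap (RingHom.id A) φ v)
        (funext (syzMap_id _ g hf hg i))).trans (freeMap_id v))
  rw [torMap, key, HomologicalComplex.homologyMap_id, Category.id_comp,
    Iso.hom_inv_id]

theorem torMap_comp (f : A →+* B) (f' : B →+* C) (f'' : A →+* C)
    (h : X →ₗ[R] X') (h' : X' →ₗ[R] X'') (h'' : X →ₗ[R] X'')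
    (hh : ∀ (a : A) (x : X), h (MulOpposite.op a • x) = MulOpposite.op (f a) • h x)
    (hh' : ∀ (b : B) (x : X'), h' (MulOpposite.op b • x) = MulOpposite.op (f' b) • h' x)
    (hh'' : ∀ (a : A) (x : X), h'' (MulOpposite.op a • x) = MulOpposite.op (f'' a) • h'' x)
    (g : M →ₛₗ[f] N) (g' : N →ₛₗ[f'] P) (g'' : M →ₛₗ[f''] P) (n : ℕ)
    (hf : ∀ a, f'' a = f' (f a)) (hx : ∀ x, h'' x = h' (h x)) (hg : ∀ m, g'' m = g' (g m)) :
    torMap f'' h'' hh'' g'' n = torMap f h hh g n ≫ torMap f' h' hh' g' n := by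
  have key : torComplexMap f'' h'' hh'' g'' =
      torComplexMap f h hh g ≫ torComplexMap f' h' hh' g' := by
    refine HomologicalComplex.Hom.ext (funext fun i => ModuleCat.hom_ext ?_)
    refine balanced_ext fun x v => congrArg Submodule.Quotient.mk ?_
    exact congrArg₂ (fun x w => x ⊗ₜ[ℤ] w) (hx x)
      (freeMap_comp f f' f'' _ _ _ hf (syzMap_comp f f' f'' g g' g'' hf hg i) v)
  rw [torMap, key, HomologicalComplex.homologyMap_comp]
  simp only [torMap, Category.assoc, Iso.inv_hom_id_assoc]

end TorMap

/-! ### Pro-objects -/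

/-- A pro-object `{X_s}` (a contravariant functor on a directed partially ordered set `S`) of the
category of `R`-modules is zero in the pro-category if and only if, for every `s`, there is
`s' ≥ s` such that the structure map `X_{s'} → X_s` is zero. -/
def IsProZero {R : Type u} [CommRing R] {S : Type v} [PartialOrder S]
    (X : Sᵒᵖ ⥤ ModuleCat.{u} R) : Prop :=
  ∀ s : S, ∃ (s' : S) (h : s ≤ s'), X.map (homOfLE h).op = 0

/-- A pro-non-unital associative `k`-algebra `{I_s}`, indexed by the partially ordered set `S`. -/
structure ProNonUnitalAlgebra (k : Type u) [CommRing k] (S : Type v) [PartialOrder S] where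
  /-- the algebras `I_s` -/
  obj : S → Type u
  [ring : ∀ s, NonUnitalRing (obj s)]
  [module : ∀ s, Module k (obj s)]
  [isScalarTower : ∀ s, IsScalarTower k (obj s) (obj s)]
  [smulCommClass : ∀ s, SMulCommClass k (obj s) (obj s)]
  /-- the structure maps `I_t → I_s`, for `s ≤ t` -/
  map : ∀ {s t : S}, s ≤ t → (obj t →ₙₐ[k] obj s)
  map_refl : ∀ (s : S) (x : obj s), map (le_refl s) x = x
  map_trans : ∀ {r s t : S} (hrs : r ≤ s) (hst : s ≤ t) (x : obj t),
    map (hrs.trans hst) x = map hrs (map hst x)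

attribute [instance] ProNonUnitalAlgebra.ring ProNonUnitalAlgebra.module
  ProNonUnitalAlgebra.isScalarTower ProNonUnitalAlgebra.smulCommClass

/-- The pro-non-unital associative `k'`-algebra `{I_s^α}` associated with `{I_s}`: the same rings
and structure maps, with `c : k'` acting as `α c : k`. -/
def ProNonUnitalAlgebra.restrictScalars {k k' : Type u} [CommRing k] [CommRing k'] {S : Type v}
    [PartialOrder S] (I : ProNonUnitalAlgebra k S) (α : k' →+* k) : ProNonUnitalAlgebra k' S :=
  letI (s : S) : Module k' (I.obj s) := Module.compHom (I.obj s) α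
  { obj := I.obj
    ring := I.ring
    module := fun s => Module.compHom (I.obj s) α
    isScalarTower := fun _ => ⟨fun c x y => smul_mul_assoc (α c) x y⟩
    smulCommClass := fun _ => ⟨fun c x y => (mul_smul_comm (α c) x y).symm⟩
    map := fun h =>
      { toFun := I.map h
        map_smul' := fun c x => (I.map h).map_smul (α c) x
        map_zero' := (I.map h).map_zero
        map_add' := (I.map h).map_add
        map_mul' := (I.map h).map_mul }
    map_refl := I.map_refl
    map_trans := I.map_trans }

/-! ### The rings `k ⋉ I` and their modules `k`

`Unitization k I` is `k × I` with the multiplication `(a, x) (a', x') = (a a', a x' + a' x + x x')`,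
that is, the ring `k ⋉ I`. -/

section Aug

variable (k : Type u) [CommRing k] (I : Type u) [NonUnitalRing I] [Module k I]
  [IsScalarTower k I I] [SMulCommClass k I I]

/-- The augmentation `k ⋉ I → k`, `(a, x) ↦ a`. -/
abbrev aug : Unitization k I →+* k := (Unitization.fstHom k I).toRingHom

/-- The additive group `k`, considered as a module over `k` and as a left and right module over
`k ⋉ I`, with `k ⋉ I` acting through the augmentation. -/
@[nolint unusedArguments]
def AugModule (k : Type u) (_I : Type u) : Type u := k

instance : AddCommGroup (AugModule k I) := inferInstanceAs (AddCommGroup k)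

instance : Module k (AugModule k I) := inferInstanceAs (Module k k)

instance : Module (Unitization k I) (AugModule k I) :=
  Module.compHom (AugModule k I) (aug k I)

instance : Module (Unitization k I)ᵐᵒᵖ (AugModule k I) :=
  Module.compHom (AugModule k I) ((aug k I).fromOpposite fun _ _ => mul_comm _ _)

instance : SMulCommClass k (Unitization k I)ᵐᵒᵖ (AugModule k I) :=
  ⟨fun a b c => mul_left_comm (G := k) a (aug k I b.unop) c⟩

/-- `Tor_q^{k ⋉ I}(k, k)`, a `k`-module. -/
abbrev augTor (q : ℕ) : ModuleCat.{u} k :=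
  (Tor k (Unitization k I) (AugModule k I) q).obj
    (ModuleCat.of (Unitization k I) (AugModule k I))

variable {k I} {J : Type u} [NonUnitalRing J] [Module k J] [IsScalarTower k J J]
  [SMulCommClass k J J]

/-- The ring homomorphism `k ⋉ I → k ⋉ J`, `(a, x) ↦ (a, f x)`. -/
def unitizationMap (f : I →ₙₐ[k] J) : Unitization k I →+* Unitization k J :=
  (Unitization.lift ((Unitization.inrNonUnitalAlgHom k J).comp f)).toRingHom

theorem unitizationMap_fst (f : I →ₙₐ[k] J) (a : Unitization k I) :
    (unitizationMap f a).fst = a.fst := by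
  simp [unitizationMap, Unitization.algebraMap_eq_inl]

theorem unitizationMap_snd (f : I →ₙₐ[k] J) (a : Unitization k I) :
    (unitizationMap f a).snd = f a.snd := by
  simp [unitizationMap, Unitization.algebraMap_eq_inl]

/-- The identity of `k`, as a map of left modules over `k ⋉ I → k ⋉ J`. -/
def augLeft (f : I →ₙₐ[k] J) :
    ModuleCat.of (Unitization k I) (AugModule k I) →ₛₗ[unitizationMap f]
      ModuleCat.of (Unitization k J) (AugModule k J) where
  toFun := (id : k → k)
  map_add' _ _ := rfl
  map_smul' a c := congrArg (HMul.hMul (β := k) (γ := k) · c) (unitizationMap_fst f a).symm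

/-- The identity of `k`, as a `k`-linear map. -/
def augRight (k I J : Type u) [CommRing k] : AugModule k I →ₗ[k] AugModule k J :=
  (LinearMap.id : k →ₗ[k] k)

theorem augRight_smul (f : I →ₙₐ[k] J) (a : Unitization k I) (c : AugModule k I) :
    augRight k I J (MulOpposite.op a • c) =
      MulOpposite.op (unitizationMap f a) • augRight k I J c :=
  congrArg (HMul.hMul (β := k) (γ := k) · c) (unitizationMap_fst f a).symm

/-- The map `Tor_q^{k ⋉ I}(k, k) → Tor_q^{k ⋉ J}(k, k)` that is induced by a homomorphism `I → J`
of non-unital algebras. -/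
def augTorMap (f : I →ₙₐ[k] J) (q : ℕ) : augTor k I q ⟶ augTor k J q :=
  torMap (unitizationMap f) (augRight k I J)
    (augRight_smul f) (augLeft f) q

end Aug

/-- The pro-`k`-module `{Tor_q^{k ⋉ I_s}(k, k)}`. -/
def proTor {k : Type u} [CommRing k] {S : Type v} [PartialOrder S]
    (I : ProNonUnitalAlgebra k S) (q : ℕ) : Sᵒᵖ ⥤ ModuleCat.{u} k where
  obj s := augTor k (I.obj s.unop) q
  map h := augTorMap (I.map (leOfHom h.unop)) q
  map_id s := torMap_id _ _ _ _ _
    (fun a => Unitization.ext (unitizationMap_fst _ a)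
      ((unitizationMap_snd _ a).trans (I.map_refl s.unop a.snd)))
    (fun _ => rfl) (fun _ => rfl)
  map_comp {r s t} g h := torMap_comp _ _ _ _ _ _ _ _ _ _ _ _ _
    (fun a => Unitization.ext
      (by simp only [unitizationMap_fst])
      (by simp only [unitizationMap_snd]; exact I.map_trans (leOfHom h.unop) (leOfHom g.unop) a.snd))
    (fun _ => rfl) (fun _ => rfl)

end ProTor

end

noncomputable section

namespace ProTor

variable {S : Type v} [PartialOrder S]

/-! ### Pro-sets and pro-abelian groups -/

/-! Let `F` be the standard free resolution of `k` over `A = k ⋉ I`, at each level. Its term `F_n`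
is free on the set `X_n` of `n`-th syzygies, so `I ⊗_A F_n` is `I[X_n]`. The sequence `0 → I ⊗ F → F
→ k ⊗ F → 0` is exact, `F` is a resolution, and `I ⊗ F_0` lies in the kernel of `F_0 → k`; hence
`Tor_{n+1}(k, k)` is `H_n(I ⊗ F)` for every `n ≥ 0`. Hypothesis and conclusion thus both become
pro-acyclicity of `I ⊗ F` (`IsAcyclic`), by `exactIn_of_isProZero` and `isProZero_of_exactIn`.

The base ring is changed in `IsAcyclic.transfer`. Let `J` be a pro-algebra over `k'` anti-isomorphic
to `I` as a pro-ring, with commuting scalars, and let `G` be the resolution for `B = k' ⋉ J`, free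
on the sets `Y_i`. Right multiplication by `J` is left multiplication by `I`, so `A` and `B` have
commuting right actions on the same group `I`, and `I[X_j][Y_i]` is a double complex. Its rows are
copies of `I ⊗ F`, pro-acyclic by assumption; its columns are copies of `J ⊗ G`, pro-exact below
degree `q` by induction on `q`. A cycle of degree `q` in `J ⊗ G`, placed at `j = 0`, therefore lifts
to a column cycle at `j = 1` (`exists_lift_isCycle`). Composing the horizontal differential with the
augmentation `I ⊗ F_0 → I` recovers the original cycle, and on each generator of `F_1` this
composite is right multiplication by an element of `I`, that is, left multiplication by an element
of `J`. Such a multiplication kills the homology of `J ⊗ G` (`exists_d_eq_finsuppHom_mulLeft`), so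
the cycle bounds.

Transfer reverses multiplication, so it is applied twice: from `I` to the opposite of `I^α`, then to
`I^α`. -/

/-- A contravariant functor from the partially ordered set `S` to sets. -/
structure ProSet (S : Type v) [PartialOrder S] where
  /-- the sets -/
  obj : S → Type u
  /-- the structure maps -/
  map : ∀ {s t : S}, s ≤ t → obj t → obj s
  map_trans : ∀ {r s t : S} (hrs : r ≤ s) (hst : s ≤ t) (x : obj t),
    map (hrs.trans hst) x = map hrs (map hst x)

/-- A contravariant functor from the partially ordered set `S` to abelian groups. -/
structure ProGroup (S : Type v) [PartialOrder S] where
  /-- the groups -/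
  obj : S → Type u
  [group : ∀ s, AddCommGroup (obj s)]
  /-- the structure maps -/
  map : ∀ {s t : S}, s ≤ t → (obj t →+ obj s)
  map_trans : ∀ {r s t : S} (hrs : r ≤ s) (hst : s ≤ t) (x : obj t),
    map (hrs.trans hst) x = map hrs (map hst x)

attribute [instance] ProGroup.group

/-- A levelwise homomorphism of pro-abelian groups. -/
structure ProGroup.Hom (N N' : ProGroup.{u, v} S) where
  /-- the components -/
  app : ∀ s, N.obj s →+ N'.obj s
  naturality : ∀ {s t : S} (h : s ≤ t) (x : N.obj t), app s (N.map h x) = N'.map h (app t x)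

/-! ### Tensoring matrices between free modules with a right module -/

section Trans

variable {X Y Z : Type u} {N N' N'' : Type u} [AddCommGroup N] [AddCommGroup N'] [AddCommGroup N'']

/-- The homomorphism `N[Y] → N'[X]`, `n · [y] ↦ h n · [g y]`. -/
def finsuppHom (g : Y → X) (h : N →+ N') : (Y →₀ N) →+ (X →₀ N') :=
  Finsupp.liftAddHom fun y => (Finsupp.singleAddHom (g y)).comp h

@[simp]
theorem finsuppHom_single (g : Y → X) (h : N →+ N') (y : Y) (n : N) :
    finsuppHom g h (Finsupp.single y n) = Finsupp.single (g y) (h n) := by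
  simp [finsuppHom]

theorem finsuppHom_finsuppHom (g : Y → X) (h : N →+ N') (g' : X → Z) (h' : N' →+ N'')
    (v : Y →₀ N) : finsuppHom g' h' (finsuppHom g h v) = finsuppHom (g' ∘ g) (h'.comp h) v := by
  induction v using Finsupp.induction_linear with
  | zero => simp only [map_zero]
  | add v w hv hw => simp only [map_add, hv, hw]
  | single y n => simp

theorem finsuppHom_id_apply (h : N →+ N') (v : Y →₀ N) (y : Y) :
    finsuppHom id h v y = h (v y) := by
  induction v using Finsupp.induction_linear with
  | zero => simp
  | add v w hv hw => simp [hv, hw]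
  | single y' n =>
    classical
    simp only [finsuppHom_single, id, Finsupp.single_apply]
    split_ifs <;> simp

variable {A : Type u} [Ring A]

/-- The homomorphism `N[Y] → N[X]` that is given by the matrix `c` over `A`, where `A` acts on `N`
through `ρ`. -/
def matrixHom (ρ : A →+ (N →+ N)) (c : Y → X →₀ A) : (Y →₀ N) →+ (X →₀ N) :=
  Finsupp.liftAddHom fun y => Finsupp.liftAddHom (fun x => AddMonoidHom.compHom
    (Finsupp.singleAddHom x) |>.comp ρ) (c y)

/-- The coordinatewise action on `N[X]`. -/
def finsuppAct (X : Type u) (ρ : A →+ (N →+ N)) : A →+ ((X →₀ N) →+ (X →₀ N)) :=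
  AddMonoidHom.mk' (fun a => finsuppHom id (ρ a)) fun a b => by
    ext x n : 2
    simp

theorem matrixHom_single (ρ : A →+ (N →+ N)) (c : Y → X →₀ A) (y : Y) (n : N) :
    matrixHom ρ c (Finsupp.single y n) = finsuppHom id (ρ.flip n) (c y) := by
  simp only [matrixHom, Finsupp.liftAddHom_apply_single]
  generalize c y = v
  induction v using Finsupp.induction_linear with
  | zero => simp
  | add v w hv hw => rw [map_add, map_add, AddMonoidHom.add_apply, hv, hw]
  | single y n => simp

/-- Both uses need this generality: with `f` a structure map it makes differentials maps of
pro-groups, and with `f` the identity it makes a change of coefficients a chain map. -/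
theorem matrixHom_natural {X' Y' : Type u} {B : Type u} [Ring B] {ρ : A →+ (N →+ N)}
    {ρ' : B →+ (N' →+ N')} {c : Y → X →₀ A} {c' : Y' → X' →₀ B} (f : A →+* B) (g : Y → Y')
    (g' : X → X') (h : N →+ N') (hc : ∀ y, c' (g y) = freeMap f g' (c y))
    (hh : ∀ a n, h (ρ a n) = ρ' (f a) (h n)) (v : Y →₀ N) :
    matrixHom ρ' c' (finsuppHom g h v) = finsuppHom g' h (matrixHom ρ c v) := by
  induction v using Finsupp.induction_linear with
  | zero => simp only [map_zero]
  | add v w hv hw => simp only [map_add, hv, hw]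
  | single y n =>
    rw [finsuppHom_single, matrixHom_single, matrixHom_single, hc]
    generalize c y = v
    induction v using Finsupp.induction_linear with
    | zero => simp only [map_zero]
    | add v w hv hw => simp only [map_add, hv, hw]
    | single x a => simp [hh]

theorem matrixHom_finsuppHom_id {ρ : A →+ (N →+ N)} {ρ' : A →+ (N' →+ N')} (c : Y → X →₀ A)
    (h : N →+ N') (hh : ∀ a n, h (ρ a n) = ρ' a (h n)) (v : Y →₀ N) :
    matrixHom ρ' c (finsuppHom id h v) = finsuppHom id h (matrixHom ρ c v) :=
  matrixHom_natural (RingHom.id A) id id h (fun y => (freeMap_id (c y)).symm) hh v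

/-- The reversed order in `hρ` is that of a right action; `matrixHom ρ` is then the functor `N ⊗_A
-` on maps of free left modules, so it respects composition. -/
theorem matrixHom_matrixHom (ρ : A →+ (N →+ N)) (hρ : ∀ a b n, ρ (a * b) n = ρ b (ρ a n))
    (c : Y → X →₀ A) (c' : X → Z →₀ A) (v : Y →₀ N) :
    matrixHom ρ c' (matrixHom ρ c v) =
      matrixHom ρ (fun y => Finsupp.linearCombination A c' (c y)) v := by
  induction v using Finsupp.induction_linear with
  | zero => simp only [map_zero]
  | add v w hv hw => simp only [map_add, hv, hw]
  | single y n =>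
    rw [matrixHom_single, matrixHom_single]
    generalize c y = v
    induction v using Finsupp.induction_linear with
    | zero => simp only [map_zero]
    | add v w hv hw => simp only [map_add, hv, hw]
    | single x a =>
      rw [finsuppHom_single, id, matrixHom_single, Finsupp.linearCombination_single]
      generalize c' x = w
      induction w using Finsupp.induction_linear with
      | zero => simp only [map_zero, smul_zero]
      | add v w hv hw => simp only [map_add, smul_add, hv, hw]
      | single z b => simp [Finsupp.smul_single, hρ, -Finsupp.single_mul]

/-- This is `A ⊗_A - = id`; it links `matrixHom` with the differential of the resolution itself. -/
theorem matrixHom_mulRight (c : Y → X →₀ A) (v : Y →₀ A) :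
    matrixHom (AddMonoidHom.mul (R := A)).flip c v = Finsupp.linearCombination A c v := by
  induction v using Finsupp.induction_linear with
  | zero => simp only [map_zero]
  | add v w hv hw => simp only [map_add, hv, hw]
  | single y a =>
    rw [matrixHom_single, Finsupp.linearCombination_single]
    generalize c y = v
    induction v using Finsupp.induction_linear with
    | zero => simp only [map_zero, smul_zero]
    | add v w hv hw => simp only [map_add, smul_add, hv, hw]
    | single x a => simp

end Trans

/-- The pro-abelian group `{N_s[Y_s]}`. -/
def ProGroup.finsupp (N : ProGroup.{u, v} S) (Y : ProSet.{u, v} S) : ProGroup.{u, v} S where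
  obj s := Y.obj s →₀ N.obj s
  map h := finsuppHom (Y.map h) (N.map h)
  map_trans hrs hst x := by
    rw [finsuppHom_finsuppHom]
    congr 2
    · exact funext fun y => Y.map_trans hrs hst y
    · exact AddMonoidHom.ext fun n => N.map_trans hrs hst n

/-! ### Complexes and double complexes of pro-abelian groups -/

/-- The element `x` of degree `n` is a cycle. -/
def IsCycle {K : ℕ → ProGroup.{u, v} S} (d : ∀ n, (K (n + 1)).Hom (K n)) {s : S} :
    ∀ {n : ℕ}, (K n).obj s → Prop
  | 0, _ => True
  | n + 1, x => (d n).app s x = 0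

/-- The pro-homology in degree `n` is zero. -/
def ExactIn {K : ℕ → ProGroup.{u, v} S} (d : ∀ n, (K (n + 1)).Hom (K n)) (n : ℕ) : Prop :=
  ∀ s : S, ∃ (t : S) (h : s ≤ t), ∀ x : (K n).obj t, IsCycle d x →
    ∃ y : (K (n + 1)).obj s, (d n).app s y = (K n).map h x

/-- A staircase argument. Lift `z` along its row to `w₁`. Then `dv w₁` is a cycle in both directions
one row lower, so by induction it is `dh w₂` for a column cycle `w₂`. Column exactness gives `w₂ =
dv u`, and `w₁ - dh u` is a column cycle with the same image as `w₁`. -/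
theorem exists_lift_isCycle {D : ℕ → ℕ → ProGroup.{u, v} S}
    (dh : ∀ i j, (D i (j + 1)).Hom (D i j)) (dv : ∀ j i, (D (i + 1) j).Hom (D i j))
    (comm : ∀ i j s x, (dh i j).app s ((dv (j + 1) i).app s x) =
      (dv j i).app s ((dh (i + 1) j).app s x))
    (dh_dh : ∀ i j s x, (dh i j).app s ((dh i (j + 1)).app s x) = 0)
    (dv_dv : ∀ j i s x, (dv j i).app s ((dv j (i + 1)).app s x) = 0)
    (hrow : ∀ i j, ExactIn (dh i) j) (q : ℕ)
    (hcol : ∀ i < q, ∀ j, ExactIn (K := fun i => D i j) (dv j) i) :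
    ∀ i ≤ q, ∀ j, ∀ s : S, ∃ (t : S) (h : s ≤ t), ∀ z : (D i j).obj t, IsCycle (dh i) z →
      IsCycle (K := fun i => D i j) (dv j) z → ∃ w : (D i (j + 1)).obj s,
        IsCycle (K := fun i => D i (j + 1)) (dv (j + 1)) w ∧ (dh i j).app s w = (D i j).map h z := by
  intro i
  induction i with
  | zero =>
    intro _ j s
    obtain ⟨t, h, H⟩ := hrow 0 j s
    refine ⟨t, h, fun z hz _ => ?_⟩
    obtain ⟨w, hw⟩ := H z hz
    exact ⟨w, trivial, hw⟩
  | succ i ih =>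
    intro hi j s
    -- Each use of exactness lowers the level, so the levels `s ≤ s₁ ≤ s₂ ≤ t` are chosen in the
    -- reverse of the order in which the exactness statements are applied.
    obtain ⟨s₁, h₁, H₁⟩ := hcol i hi (j + 1 + 1) s
    obtain ⟨s₂, h₂, H₂⟩ := ih (by omega) (j + 1) s₁
    obtain ⟨t, h₃, H₃⟩ := hrow (i + 1) j s₂
    refine ⟨t, h₁.trans (h₂.trans h₃), fun z hz hz' => ?_⟩
    obtain ⟨w₁, hw₁⟩ := H₃ z hz
    obtain ⟨w₂, hw₂, hw₂'⟩ := H₂ ((dv (j + 1) i).app s₂ w₁)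
      (by
        change (dh i j).app s₂ _ = 0
        rw [comm, hw₁, (dv j i).naturality]
        exact (congrArg _ hz').trans (map_zero _))
      (by
        cases i with
        | zero => trivial
        | succ i => exact dv_dv _ _ _ _)
    obtain ⟨u, hu⟩ := H₁ w₂ hw₂
    refine ⟨(D (i + 1) (j + 1)).map (h₁.trans h₂) w₁ - (dh (i + 1) (j + 1)).app s u, ?_, ?_⟩
    · change (dv (j + 1) i).app s _ = 0
      rw [map_sub, (dv (j + 1) i).naturality, ← comm, hu, (dh i (j + 1)).naturality, hw₂',
        (D i (j + 1)).map_trans h₁ h₂, sub_self]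
    · rw [map_sub, dh_dh, sub_zero, (dh (i + 1) j).naturality, hw₁, ← (D (i + 1) j).map_trans]

/-! ### Complexes obtained from the standard resolution -/

theorem linearCombination_syz {A : Type u} [Ring A] (M : ModuleCat.{u} A) (n : ℕ)
    (v : syz A M (n + 1) →₀ A) :
    Finsupp.linearCombination A (fun y : syz A M (n + 1) => (y.1 : syz A M n →₀ A)) v =
      stdD A M n v := by
  induction v using Finsupp.induction_linear with
  | zero => simp only [map_zero]
  | add v w hv hw => simp only [map_add, hv, hw]
  | single y a =>
    rw [Finsupp.linearCombination_single]
    exact (congrArg (LinearMap.ker (freeCounit A (syz A M n))).subtype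
      (Finsupp.linearCombination_single A (v := id) a y)).symm

/-- The rows of the product matrix are `stdD` applied to syzygies, and a syzygy lies in the kernel
of `stdD` by construction. -/
theorem matrixHom_syz_comp {A : Type u} [Ring A] (M : ModuleCat.{u} A) (n : ℕ) {N : Type u}
    [AddCommGroup N] (ρ : A →+ (N →+ N)) (hρ : ∀ a b n, ρ (a * b) n = ρ b (ρ a n))
    (v : syz A M (n + 1 + 1) →₀ N) :
    matrixHom ρ (fun y : syz A M (n + 1) => (y.1 : syz A M n →₀ A))
      (matrixHom ρ (fun y : syz A M (n + 1 + 1) => (y.1 : syz A M (n + 1) →₀ A)) v) = 0 := by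
  rw [matrixHom_matrixHom ρ hρ]
  have h0 : (fun y : syz A M (n + 1 + 1) => Finsupp.linearCombination A
      (fun y : syz A M (n + 1) => (y.1 : syz A M n →₀ A)) y.1) = fun _ => 0 :=
    funext fun y => (linearCombination_syz M n y.1).trans ((stdD_eq_zero_iff A M n y.1).2 y.2)
  rw [h0]
  induction v using Finsupp.induction_linear with
  | zero => simp only [map_zero]
  | add v w hv hw => simp only [map_add, hv, hw, add_zero]
  | single y a => rw [matrixHom_single, map_zero]

/-! ### The right module `I` over `k ⋉ I` and the inclusion of `I ⊗ F` in `F` -/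

section Level

variable (k : Type u) [CommRing k] (I : Type u) [NonUnitalRing I] [Module k I]
  [IsScalarTower k I I] [SMulCommClass k I I]

/-- The module `k` over `k ⋉ I`. -/
abbrev augCat : ModuleCat.{u} (Unitization k I) :=
  ModuleCat.of (Unitization k I) (AugModule k I)

/-- The iterated syzygies of the module `k` over `k ⋉ I`. -/
abbrev augSyz (n : ℕ) : Type u := syz (Unitization k I) (augCat k I) n

/-- The matrix of the differential of the standard resolution of `k` over `k ⋉ I`. -/
abbrev augMatrix (n : ℕ) (y : augSyz k I (n + 1)) : augSyz k I n →₀ Unitization k I := y.1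

/-- The right action of `k ⋉ I` on `I`. -/
def rightMul : Unitization k I →+ (I →+ I) where
  toFun a :=
    { toFun := fun x => a.fst • x + x * a.snd
      map_zero' := by simp
      map_add' := fun x y => by rw [smul_add, add_mul]; abel }
  map_zero' := by ext; simp
  map_add' a b := by
    ext x
    simp only [Unitization.fst_add, Unitization.snd_add, add_smul, mul_add, AddMonoidHom.coe_mk,
      ZeroHom.coe_mk, AddMonoidHom.add_apply]
    abel

variable {k I}

omit [IsScalarTower k I I] [SMulCommClass k I I] in
theorem rightMul_apply (a : Unitization k I) (x : I) :
    rightMul k I a x = a.fst • x + x * a.snd := rfl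

theorem rightMul_mul (a b : Unitization k I) (x : I) :
    rightMul k I (a * b) x = rightMul k I b (rightMul k I a x) := by
  simp only [rightMul_apply, Unitization.fst_mul, Unitization.snd_mul, mul_add, add_mul, smul_add,
    mul_smul_comm, smul_mul_assoc, mul_assoc]
  rw [mul_comm a.fst, mul_smul]
  abel

variable {J : Type u} [NonUnitalRing J] [Module k J] [IsScalarTower k J J] [SMulCommClass k J J]

theorem map_rightMul (f : I →ₙₐ[k] J) (a : Unitization k I) (x : I) :
    f (rightMul k I a x) = rightMul k J (unitizationMap f a) (f x) := by
  simp [rightMul_apply, unitizationMap_fst, unitizationMap_snd]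

variable (k I) in
/-- The inclusion `I[X] → (k ⋉ I)[X]`. -/
def finsuppInr (X : Type u) : (X →₀ I) →+ (X →₀ Unitization k I) :=
  finsuppHom id (Unitization.inrNonUnitalAlgHom k I : I →+ Unitization k I)

omit [IsScalarTower k I I] [SMulCommClass k I I] in
@[simp]
theorem finsuppInr_apply {X : Type u} (v : X →₀ I) (x : X) :
    finsuppInr k I X v x = (v x : Unitization k I) :=
  finsuppHom_id_apply _ v x

omit [IsScalarTower k I I] [SMulCommClass k I I] in
theorem finsuppInr_injective {X : Type u} : Function.Injective (finsuppInr k I X) := by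
  intro v w h
  ext x
  simpa using congrArg (fun a : Unitization k I => a.snd) (DFunLike.congr_fun h x)

omit [IsScalarTower k I I] [SMulCommClass k I I] in
theorem exists_finsuppInr_eq {X : Type u} (v : X →₀ Unitization k I) (hv : ∀ x, (v x).fst = 0) :
    ∃ w, finsuppInr k I X w = v := by
  refine ⟨v.mapRange (fun a => a.snd) Unitization.snd_zero, ?_⟩
  ext x
  · simp [hv]
  · rw [finsuppInr_apply, Unitization.snd_inr, Finsupp.mapRange_apply]

/-- `rightMul` is right multiplication in `k ⋉ I` restricted to the ideal `I`; hence `I ⊗ F → F` is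
a chain map. -/
theorem stdD_finsuppInr (n : ℕ) (v : augSyz k I (n + 1) →₀ I) :
    stdD (Unitization k I) (augCat k I) n (finsuppInr k I _ v) =
      finsuppInr k I _ (matrixHom (rightMul k I) (augMatrix k I n) v) := by
  rw [← linearCombination_syz, ← matrixHom_mulRight]
  refine matrixHom_finsuppHom_id _ _ (fun a n => ?_) v
  ext <;> simp [rightMul_apply]

theorem freeMap_finsuppInr (f : I →ₙₐ[k] J) {X Y : Type u} (g : X → Y) (v : X →₀ I) :
    freeMap (unitizationMap f) g (finsuppInr k I X v) =
      finsuppInr k J Y (finsuppHom g (f : I →+ J) v) := by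
  induction v using Finsupp.induction_linear with
  | zero => simp only [map_zero]
  | add v w hv hw => simp only [map_add, hv, hw]
  | single x a =>
    simp only [finsuppInr, finsuppHom_single, freeMap_single, id]
    congr 1
    ext <;> simp [unitizationMap_fst, unitizationMap_snd]

theorem augMatrix_syzMap (f : I →ₙₐ[k] J) (n : ℕ) (y : augSyz k I (n + 1)) :
    augMatrix k J n (syzMap (unitizationMap f) (augLeft f) (n + 1) y) =
      freeMap (unitizationMap f) (syzMap (unitizationMap f) (augLeft f) n) (augMatrix k I n y) :=
  rfl

theorem smul_augModule (a : Unitization k I) (c : AugModule k I) :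
    a • c = (a.fst * (show k from c) : k) := rfl

theorem freeCounit_finsuppInr (v : AugModule k I →₀ I) :
    freeCounit (Unitization k I) (AugModule k I) (finsuppInr k I _ v) = 0 := by
  induction v using Finsupp.induction_linear with
  | zero => simp only [map_zero]
  | add v w hv hw => simp only [map_add, hv, hw, add_zero]
  | single x a =>
    rw [finsuppInr, finsuppHom_single, freeCounit, Finsupp.linearCombination_single]
    exact (smul_augModule _ _).trans (zero_mul (M₀ := k) _)

end Level

/-- The pro-set of iterated syzygies of `k` over `k ⋉ I_s`. -/
def ProNonUnitalAlgebra.syz {k : Type u} [CommRing k] (I : ProNonUnitalAlgebra.{u, v} k S)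
    (n : ℕ) : ProSet.{u, v} S where
  obj s := augSyz k (I.obj s) n
  map h := syzMap (unitizationMap (I.map h)) (augLeft (I.map h)) n
  map_trans hrs hst x := syzMap_comp _ _ _ _ _ _
    (fun a => Unitization.ext
      (by simp only [unitizationMap_fst])
      (by simp only [unitizationMap_snd]; exact I.map_trans hrs hst a.snd))
    (fun _ => rfl) n x

/-- The pro-abelian group underlying `{I_s}`. -/
def ProNonUnitalAlgebra.toProGroup {k : Type u} [CommRing k] (I : ProNonUnitalAlgebra.{u, v} k S) :
    ProGroup.{u, v} S where
  obj s := I.obj s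
  map h := (I.map h : _ →+ _)
  map_trans := I.map_trans

/-- A right action of the pro-ring `{k ⋉ I_s}` on a pro-abelian group. -/
structure ProAction {k : Type u} [CommRing k] (I : ProNonUnitalAlgebra.{u, v} k S)
    (N : ProGroup.{u, v} S) where
  /-- the action of `k ⋉ I_s` -/
  act : ∀ s, Unitization k (I.obj s) →+ (N.obj s →+ N.obj s)
  act_mul : ∀ s a b x, act s (a * b) x = act s b (act s a x)
  map_act : ∀ {s t : S} (h : s ≤ t) a x,
    N.map h (act t a x) = act s (unitizationMap (I.map h) a) (N.map h x)

section ProAction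

variable {k : Type u} [CommRing k] {I : ProNonUnitalAlgebra.{u, v} k S}

variable (I) in
/-- The right action of `{k ⋉ I_s}` on `{I_s}`. -/
def ProAction.self : ProAction I I.toProGroup where
  act s := rightMul k (I.obj s)
  act_mul _ := rightMul_mul
  map_act h := map_rightMul (I.map h)

/-- The coordinatewise action on `{N_s[X_s]}`. -/
def ProAction.finsupp {N : ProGroup.{u, v} S} (ρ : ProAction I N) (X : ProSet.{u, v} S) :
    ProAction I (N.finsupp X) where
  act s := finsuppAct (X.obj s) (ρ.act s)
  act_mul s a b v := by
    refine ((finsuppHom_finsuppHom id (ρ.act s a) id (ρ.act s b) v).trans ?_).symm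
    exact congrArg (fun φ => finsuppHom id φ v) (AddMonoidHom.ext fun x => (ρ.act_mul s a b x).symm)
  map_act h a v := by
    refine (finsuppHom_finsuppHom _ _ _ _ v).trans
      (Eq.trans ?_ (finsuppHom_finsuppHom _ _ _ _ v).symm)
    congr 2
    exact AddMonoidHom.ext fun x => ρ.map_act h a x

/-- The differential `{N_s[syz (n + 1)]} → {N_s[syz n]}` of the complex obtained from the standard
resolution of `k` over `k ⋉ I_s`. -/
def ProAction.d {N : ProGroup.{u, v} S} (ρ : ProAction I N) (n : ℕ) :
    (N.finsupp (I.syz (n + 1))).Hom (N.finsupp (I.syz n)) where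
  app s := matrixHom (ρ.act s) (augMatrix k (I.obj s) n)
  naturality h v := matrixHom_natural (unitizationMap (I.map h)) _ _ _
    (augMatrix_syzMap (I.map h) n) (ρ.map_act h) v

theorem ProAction.d_d {N : ProGroup.{u, v} S} (ρ : ProAction I N) (n : ℕ) (s : S)
    (v : (N.finsupp (I.syz (n + 1 + 1))).obj s) : (ρ.d n).app s ((ρ.d (n + 1)).app s v) = 0 :=
  matrixHom_syz_comp _ n _ (ρ.act_mul s) v

/-- An equivariant homomorphism of coefficients induces a chain map. -/
theorem ProAction.d_finsuppHom {N N' : ProGroup.{u, v} S} (ρ : ProAction I N) (ρ' : ProAction I N')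
    (n : ℕ) (s : S) (f : N.obj s →+ N'.obj s) (hf : ∀ a x, f (ρ.act s a x) = ρ'.act s a (f x))
    (v : (N.finsupp (I.syz (n + 1))).obj s) :
    (ρ'.d n).app s (finsuppHom id f v) = finsuppHom id f ((ρ.d n).app s v) :=
  matrixHom_finsuppHom_id _ f hf v

theorem ProAction.isCycle_finsuppHom {N N' : ProGroup.{u, v} S} (ρ : ProAction I N)
    (ρ' : ProAction I N') {n : ℕ} (s : S) (f : N.obj s →+ N'.obj s)
    (hf : ∀ a x, f (ρ.act s a x) = ρ'.act s a (f x)) (v : (N.finsupp (I.syz n)).obj s)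
    (hv : IsCycle (K := fun n => N.finsupp (I.syz n)) ρ.d v) :
    IsCycle (K := fun n => N'.finsupp (I.syz n)) ρ'.d (finsuppHom id f v) := by
  cases n with
  | zero => trivial
  | succ n =>
    change (ρ'.d n).app s _ = 0
    rw [ρ.d_finsuppHom ρ' n s f hf]
    exact (congrArg _ hv).trans (map_zero _)

end ProAction

/-- The pro-homology of the complexes `I_s ⊗ F_s`, where `F_s` is the standard resolution of `k`
over `k ⋉ I_s`, is zero in all degrees. -/
def ProNonUnitalAlgebra.IsAcyclic {k : Type u} [CommRing k] (I : ProNonUnitalAlgebra.{u, v} k S) :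
    Prop :=
  ∀ n, ExactIn (K := fun n => I.toProGroup.finsupp (I.syz n)) (ProAction.self I).d n

section Level

variable {k : Type u} [CommRing k] {I : ProNonUnitalAlgebra.{u, v} k S}

/-- Degree `0` is no exception, although every element there counts as a cycle: elements of `I[X_0]`
are killed by the augmentation, and the augmented resolution is exact. -/
theorem exists_stdD_eq_finsuppInr {n : ℕ} {s : S} (v : augSyz k (I.obj s) n →₀ I.obj s)
    (hv : IsCycle (K := fun n => I.toProGroup.finsupp (I.syz n)) (ProAction.self I).d (n := n)
      (s := s) v) :
    ∃ u, stdD _ (augCat k (I.obj s)) n u = finsuppInr k _ _ v := by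
  refine exact_freeCounit _ _ _ _ ?_
  cases n with
  | zero => exact freeCounit_finsuppInr (k := k) (I := I.obj s) v
  | succ n =>
    refine (stdD_eq_zero_iff _ _ n _).1 ?_
    rw [stdD_finsuppInr]
    exact (congrArg _ hv).trans (map_zero _)

end Level

/-! ### Comparison of the complexes for anti-isomorphic algebras over different base rings -/

/-- Splits an element of `N[X][Y]` by its inner index, so that questions with coefficients in `N[X]`
reduce to coefficients in `N`. -/
theorem exists_finset_sum_single {X Y N : Type u} [AddCommGroup N] (z : Y →₀ X →₀ N) :
    ∃ T : Finset X, ∑ x ∈ T, finsuppHom id (Finsupp.singleAddHom x)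
      (finsuppHom id (Finsupp.applyAddHom x) z) = z := by
  classical
  refine ⟨z.support.biUnion fun y => (z y).support, Finsupp.ext fun y => ?_⟩
  simp only [Finsupp.finsetSum_apply, finsuppHom_id_apply, Finsupp.applyAddHom_apply,
    Finsupp.singleAddHom_apply]
  by_cases hy : z y = 0
  · simp [hy]
  · refine (Finsupp.sum_of_support_subset (z y) ?_ (fun x n => Finsupp.single x n)
      (fun _ _ => Finsupp.single_zero _)).symm.trans (Finsupp.sum_single (z y))
    exact Finset.subset_biUnion_of_mem (fun y => (z y).support) (Finsupp.mem_support_iff.2 hy)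

/-- The homomorphism `{N_s[Y_s]} → {N'_s[Y_s]}` induced by a homomorphism of coefficients. -/
def ProGroup.Hom.finsupp {N N' : ProGroup.{u, v} S} (f : N.Hom N') (Y : ProSet.{u, v} S) :
    (N.finsupp Y).Hom (N'.finsupp Y) where
  app s := finsuppHom id (f.app s)
  naturality h x := by
    refine (finsuppHom_finsuppHom _ _ _ _ x).trans
      (Eq.trans ?_ (finsuppHom_finsuppHom _ _ _ _ x).symm)
    congr 2
    exact AddMonoidHom.ext fun n => f.naturality h n

/-- The level `t` depends on `s` alone, so one `t` serves all coordinates; finite support then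
allows the coordinatewise primitives to be summed. This gives the rows of the double complex. -/
theorem ExactIn.finsupp {K : ℕ → ProGroup.{u, v} S} {d : ∀ n, (K (n + 1)).Hom (K n)} {n : ℕ}
    (hd : ExactIn d n) (Y : ProSet.{u, v} S) :
    ExactIn (K := fun n => (K n).finsupp Y) (fun n => (d n).finsupp Y) n := by
  intro s
  obtain ⟨t, h, H⟩ := hd s
  refine ⟨t, h, fun (z : Y.obj t →₀ (K n).obj t) hz => ?_⟩
  have hz' : ∀ y, IsCycle d (z y) := by
    intro y
    cases n with
    | zero => trivial
    | succ n =>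
      exact (finsuppHom_id_apply _ _ y).symm.trans
        (DFunLike.congr_fun (F := Y.obj t →₀ (K n).obj t) hz y)
  choose w hw using fun y => H _ (hz' y)
  let w' (y : Y.obj t) : ((K (n + 1)).finsupp Y).obj s := Finsupp.single (Y.map h y) (w y)
  let z' (y : Y.obj t) : ((K n).finsupp Y).obj t := Finsupp.single y (z y)
  have key (y : Y.obj t) : ((d n).finsupp Y).app s (w' y) = ((K n).finsupp Y).map h (z' y) := by
    refine (finsuppHom_single id ((d n).app s) (Y.map h y) (w y)).trans ?_
    rw [hw]
    exact (finsuppHom_single (Y.map h) ((K n).map h) y (z y)).symm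
  refine ⟨∑ y ∈ z.support, w' y, (map_sum (((d n).finsupp Y).app s) w' _).trans ?_⟩
  refine (Finset.sum_congr rfl fun y _ => key y).trans ?_
  exact (map_sum (((K n).finsupp Y).map h) z' _).symm.trans (congrArg _ (Finsupp.sum_single z))

section

variable {k : Type u} [CommRing k] {I : ProNonUnitalAlgebra.{u, v} k S}

/-- Now the extra index is inside the coefficients. Taking and inserting an `x`-coordinate are
equivariant, so the problem splits over finitely many `x`. This gives the columns of the double
complex. -/
theorem ProAction.exactIn_finsupp {N : ProGroup.{u, v} S} {ρ : ProAction I N} {n : ℕ}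
    (hρ : ExactIn (K := fun n => N.finsupp (I.syz n)) ρ.d n) (X : ProSet.{u, v} S) :
    ExactIn (K := fun n => (N.finsupp X).finsupp (I.syz n)) (ρ.finsupp X).d n := by
  intro s
  obtain ⟨t, h, H⟩ := hρ s
  refine ⟨t, h, fun z hz => ?_⟩
  have hz' (x : X.obj t) : IsCycle (K := fun n => N.finsupp (I.syz n)) ρ.d (n := n) (s := t)
      (finsuppHom id (Finsupp.applyAddHom x) z) :=
    (ρ.finsupp X).isCycle_finsuppHom ρ t (Finsupp.applyAddHom x)
      (fun a v => finsuppHom_id_apply _ v x) z hz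
  choose w hw using fun x => H _ (hz' x)
  obtain ⟨T, hT⟩ := exists_finset_sum_single (X := X.obj t) (N := N.obj t) z
  let w' (x : X.obj t) : ((N.finsupp X).finsupp (I.syz (n + 1))).obj s :=
    finsuppHom id (Finsupp.singleAddHom (X.map h x)) (w x)
  let z' (x : X.obj t) : ((N.finsupp X).finsupp (I.syz n)).obj t :=
    finsuppHom id (Finsupp.singleAddHom x) (finsuppHom id (Finsupp.applyAddHom x) z)
  have key (x : X.obj t) : ((ρ.finsupp X).d n).app s (w' x) =
      ((N.finsupp X).finsupp (I.syz n)).map h (z' x) := by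
    refine (ρ.d_finsuppHom (ρ.finsupp X) n s (Finsupp.singleAddHom (X.map h x))
      (fun a v => (finsuppHom_single id (ρ.act s a) (X.map h x) v).symm) (w x)).trans ((congrArg _ (hw x)).trans ?_)
    refine (finsuppHom_finsuppHom _ _ _ _ _).trans
      (Eq.trans ?_ (finsuppHom_finsuppHom _ _ _ _ _).symm)
    congr 2
    exact AddMonoidHom.ext fun n => (finsuppHom_single _ _ _ _).symm
  refine ⟨∑ x ∈ T, w' x, (map_sum (((ρ.finsupp X).d n).app s) w' T).trans ?_⟩
  refine (Finset.sum_congr rfl fun x _ => key x).trans ?_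
  exact (map_sum (((N.finsupp X).finsupp (I.syz n)).map h) z' T).symm.trans (congrArg _ hT)

/-- Transport of an action along an isomorphism. -/
def ProAction.congr {N N' : ProGroup.{u, v} S} (ρ : ProAction I N) (e : ∀ s, N.obj s ≃+ N'.obj s)
    (he : ∀ {s t : S} (h : s ≤ t) x, e s (N.map h x) = N'.map h (e t x)) : ProAction I N' where
  act s := AddMonoidHom.mk'
    (fun a => (e s).toAddMonoidHom.comp ((ρ.act s a).comp (e s).symm.toAddMonoidHom))
    fun a b => AddMonoidHom.ext fun x => by simp
  act_mul s a b x := by simp [ρ.act_mul]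
  map_act {s t} h a x := by
    obtain ⟨x, rfl⟩ := (e t).surjective x
    simp [← he, ρ.map_act]

theorem ProAction.congr_act {N N' : ProGroup.{u, v} S} (ρ : ProAction I N)
    (e : ∀ s, N.obj s ≃+ N'.obj s)
    (he : ∀ {s t : S} (h : s ≤ t) x, e s (N.map h x) = N'.map h (e t x)) (s : S) (a x) :
    (ρ.congr e he).act s a (e s x) = e s (ρ.act s a x) :=
  congrArg (fun y => e s (ρ.act s a y)) ((e s).symm_apply_apply x)

theorem ProAction.exactIn_congr {N N' : ProGroup.{u, v} S} {ρ : ProAction I N}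
    (e : ∀ s, N.obj s ≃+ N'.obj s)
    (he : ∀ {s t : S} (h : s ≤ t) x, e s (N.map h x) = N'.map h (e t x)) {n : ℕ}
    (hρ : ExactIn (K := fun n => N.finsupp (I.syz n)) ρ.d n) :
    ExactIn (K := fun n => N'.finsupp (I.syz n)) (ρ.congr e he).d n := by
  intro s
  obtain ⟨t, h, H⟩ := hρ s
  refine ⟨t, h, fun z hz => ?_⟩
  obtain ⟨w, hw⟩ := H (finsuppHom id (e t).symm.toAddMonoidHom z)
    ((ρ.congr e he).isCycle_finsuppHom ρ t _ (fun a x => by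
      obtain ⟨x, rfl⟩ := (e t).surjective x
      rw [congr_act]
      simp) z hz)
  refine ⟨finsuppHom id (e s).toAddMonoidHom w, ?_⟩
  rw [ρ.d_finsuppHom (ρ.congr e he) n s (e s).toAddMonoidHom
    (fun a x => (ρ.congr_act e he s a x).symm), hw]
  refine (finsuppHom_finsuppHom _ _ _ _ _).trans ((finsuppHom_finsuppHom _ _ _ _ _).trans ?_)
  refine congrArg (fun φ => finsuppHom _ φ z) (AddMonoidHom.ext fun n => ?_)
  exact (he h _).trans (congrArg _ ((e t).apply_symm_apply n))

end

/-! ### The augmentation `I ⊗ F_0 → I` and multiplication by elements of `I` -/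

section Level

variable {k : Type u} [CommRing k] {I : Type u} [NonUnitalRing I] [Module k I]
  [IsScalarTower k I I] [SMulCommClass k I I]

theorem rightMul_mul_inl (a : Unitization k I) (c : k) (x : I) :
    rightMul k I (a * Unitization.inl c) x = c • rightMul k I a x := by
  rw [rightMul_mul, rightMul_apply, Unitization.fst_inl, Unitization.snd_inl, mul_zero, add_zero]

variable (k I) in
/-- The homomorphism `I[k] → I`, `x · [c] ↦ c x`. -/
def augSyzZeroHom : (augSyz k I 0 →₀ I) →+ I :=
  Finsupp.liftAddHom fun c : augSyz k I 0 => DistribSMul.toAddMonoidHom I (show k from c)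

theorem augSyzZeroHom_single (c : augSyz k I 0) (x : I) :
    augSyzZeroHom k I (Finsupp.single c x) = (show k from c) • x :=
  Finsupp.liftAddHom_apply_single _ _ _

variable (k I) in
/-- The `k ⋉ I`-linear map from the free module on `k` to `k ⋉ I` that lifts the identity
of `k`. -/
def augLift : (augSyz k I 0 →₀ Unitization k I) →ₗ[Unitization k I] Unitization k I :=
  Finsupp.linearCombination (Unitization k I) fun c : augSyz k I 0 =>
    (Unitization.inl (show k from c) : Unitization k I)

/-- Consequently `augLift` carries first syzygies, the kernel of the augmentation of `F_0`, into
`I`. -/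
theorem augLift_fst (v : augSyz k I 0 →₀ Unitization k I) :
    (augLift k I v).fst = freeCounit (Unitization k I) (augSyz k I 0) v := by
  induction v using Finsupp.induction_linear with
  | zero => simp only [map_zero]; rfl
  | add v w hv hw => rw [map_add, Unitization.fst_add, hv, hw]; exact (map_add _ _ _).symm
  | single c a =>
    rw [augLift, Finsupp.linearCombination_single]
    exact (Finsupp.linearCombination_single _ a c (v := (id : augSyz k I 0 → _))).symm

theorem augSyzZeroHom_finsuppHom (v : augSyz k I 0 →₀ Unitization k I) (x : I) :
    augSyzZeroHom k I (finsuppHom id ((rightMul k I).flip x) v) =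
      rightMul k I (augLift k I v) x := by
  induction v using Finsupp.induction_linear with
  | zero => simp only [map_zero]; rfl
  | add v w hv hw => simp only [map_add, hv, hw, AddMonoidHom.add_apply]
  | single c a =>
    rw [finsuppHom_single, augLift, Finsupp.linearCombination_single, augSyzZeroHom_single]
    exact (rightMul_mul_inl a _ x).symm

/-- `augSyzZeroHom` is `I ⊗ augLift`, so the composite sends `x · [y]` to `x` times `augLift y`, and
that factor has no scalar part because `y` is a syzygy. -/
theorem augSyzZeroHom_matrixHom_single (y : augSyz k I 1) (x : I) :
    augSyzZeroHom k I (matrixHom (rightMul k I) (augMatrix k I 0) (Finsupp.single y x)) =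
      x * (augLift k I (augMatrix k I 0 y)).snd := by
  rw [matrixHom_single, augSyzZeroHom_finsuppHom, rightMul_apply, augLift_fst]
  have : freeCounit (Unitization k I) (augSyz k I 0) (augMatrix k I 0 y) = 0 := y.2
  rw [this]
  refine (congrArg (· + _) (zero_smul k x)).trans (zero_add _)

end Level

section Level

variable {k : Type u} [CommRing k] {I : ProNonUnitalAlgebra.{u, v} k S}

/-- Left multiplication by an element of `I_s` annihilates the homology of `I_s ⊗ F_s`. -/
theorem exists_d_eq_finsuppHom_mulLeft {n : ℕ} {s : S} (a : I.obj s)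
    (v : (I.toProGroup.finsupp (I.syz n)).obj s)
    (hv : IsCycle (K := fun n => I.toProGroup.finsupp (I.syz n)) (ProAction.self I).d v) :
    ∃ u, ((ProAction.self I).d n).app s u = finsuppHom id (AddMonoidHom.mulLeft a) v := by
  obtain ⟨u, hu⟩ := exists_stdD_eq_finsuppInr v hv
  -- In `F` the cycle bounds some `u`. The map `b ↦ a b` from `k ⋉ I` to `I` is right linear, so it
  -- turns `u` into a chain of `I ⊗ F` with boundary `a v`.
  refine ⟨finsuppHom id ((rightMul k (I.obj s)).flip a) u, ?_⟩
  refine (matrixHom_finsuppHom_id (ρ := (AddMonoidHom.mul (R := Unitization k (I.obj s))).flip)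
    (ρ' := rightMul k (I.obj s)) (augMatrix k (I.obj s) n) ((rightMul k (I.obj s)).flip a)
    (fun b c => rightMul_mul c b a) u).trans ?_
  rw [matrixHom_mulRight, linearCombination_syz]
  refine (congrArg _ hu).trans ((finsuppHom_finsuppHom _ _ _ _ v).trans ?_)
  refine congrArg (fun φ => finsuppHom id φ v) (AddMonoidHom.ext fun (x : I.obj s) => ?_)
  change rightMul k (I.obj s) (x : Unitization k (I.obj s)) a = a * x
  rw [rightMul_apply, Unitization.fst_inr, Unitization.snd_inr, zero_smul, zero_add]

end Level

/-! ### The double complex of an anti-isomorphism -/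

section Transfer

variable {k k' : Type u} [CommRing k] [CommRing k'] {I : ProNonUnitalAlgebra.{u, v} k S}
  {J : ProNonUnitalAlgebra.{u, v} k' S} (e : ∀ s, J.obj s ≃+ I.obj s)

/-- Through the anti-isomorphism `e`, right multiplication in `J` becomes left multiplication in
`I`; it commutes with right multiplication by associativity, and the two scalar actions commute by
`e_smul`. -/
theorem rightMul_comm_conj {s : S} (e : J.obj s ≃+ I.obj s)
    (e_mul : ∀ x y, e (x * y) = e y * e x)
    (e_smul : ∀ (c : k) (c' : k') x, c • e (c' • x) = e (c' • e.symm (c • e x)))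
    (a : Unitization k (I.obj s)) (b : Unitization k' (J.obj s)) (x : J.obj s) :
    rightMul k _ a (e (rightMul k' _ b x)) = e (rightMul k' _ b (e.symm (rightMul k _ a (e x)))) := by
  have e_symm_mul (x y) : e.symm (x * y) = e.symm y * e.symm x :=
    e.injective (by simp [e_mul])
  obtain ⟨y, hy⟩ : ∃ y, a.snd = e y := ⟨e.symm a.snd, by simp⟩
  have h (x y : J.obj s) : b.fst • (y * x) = y * b.fst • x := (mul_smul_comm _ _ _).symm
  have h' (c : k) (x y : I.obj s) : x * c • y = c • (x * y) := mul_smul_comm _ _ _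
  simp only [rightMul_apply, map_add, e_mul, hy, e_symm_mul, e.symm_apply_apply, e_smul,
    mul_assoc, h, e.apply_symm_apply, h']
  abel

variable (e_map : ∀ {s t : S} (h : s ≤ t) x, e s (J.map h x) = I.map h (e t x))

/-- The action of `{k' ⋉ J_s}` on `{I_s}` through an isomorphism of pro-groups `{J_s} ≃ {I_s}`. -/
def conjAction : ProAction J I.toProGroup :=
  ProAction.congr (N := J.toProGroup) (N' := I.toProGroup) (ProAction.self J) e e_map

theorem conjAction_act (s : S) (b : Unitization k' (J.obj s)) (x : J.obj s) :
    (conjAction e e_map).act s b (e s x) = e s (rightMul k' _ b x) :=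
  ProAction.congr_act (N := J.toProGroup) (N' := I.toProGroup) (ProAction.self J) e e_map s b x

theorem exactIn_conjAction {q : ℕ}
    (hq : ExactIn (K := fun n => J.toProGroup.finsupp (J.syz n)) (ProAction.self J).d q) :
    ExactIn (K := fun n => I.toProGroup.finsupp (J.syz n)) (conjAction e e_map).d q :=
  ProAction.exactIn_congr (N := J.toProGroup) (N' := I.toProGroup) e e_map hq

theorem d_conjAction (e_mul : ∀ s x y, e s (x * y) = e s y * e s x)
    (e_smul : ∀ s (c : k) (c' : k') x,
      c • e s (c' • x) = e s (c' • (e s).symm (c • e s x))) (j : ℕ) (s : S)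
    (b : Unitization k' (J.obj s)) (v : (I.toProGroup.finsupp (I.syz (j + 1))).obj s) :
    ((ProAction.self I).d j).app s (((conjAction e e_map).finsupp (I.syz (j + 1))).act s b v) =
      ((conjAction e e_map).finsupp (I.syz j)).act s b (((ProAction.self I).d j).app s v) := by
  refine matrixHom_finsuppHom_id (ρ := rightMul k (I.obj s)) (ρ' := rightMul k (I.obj s))
    (augMatrix k (I.obj s) j) ((conjAction e e_map).act s b) (fun a x => ?_) v
  obtain ⟨x, rfl⟩ := (e s).surjective x
  refine Eq.trans ?_ (((rightMul_comm_conj (e s) (e_mul s) (e_smul s) a b x).symm).trans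
    (congrArg _ (conjAction_act e e_map s b x).symm))
  exact (congrArg ((conjAction e e_map).act s b) ((e s).apply_symm_apply _).symm).trans
    (conjAction_act e e_map s b _)

/-- The staircase in the double complex `I[X_j][Y_i]`, from position `(q, 0)` to `(q, 1)`. Only
columns in degrees below `q` enter, which is what induction on `q` provides. -/
theorem exists_lift_finsupp (hI : I.IsAcyclic) (e_mul : ∀ s x y, e s (x * y) = e s y * e s x)
    (e_smul : ∀ s (c : k) (c' : k') x,
      c • e s (c' • x) = e s (c' • (e s).symm (c • e s x))) {q : ℕ}
    (hq : ∀ i < q, ExactIn (K := fun n => J.toProGroup.finsupp (J.syz n)) (ProAction.self J).d i)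
    (s : S) :
    ∃ (t : S) (h : s ≤ t), ∀ z : ((I.toProGroup.finsupp (I.syz 0)).finsupp (J.syz q)).obj t,
      IsCycle (K := fun n => (I.toProGroup.finsupp (I.syz 0)).finsupp (J.syz n))
        ((conjAction e e_map).finsupp (I.syz 0)).d z →
      ∃ w : ((I.toProGroup.finsupp (I.syz 1)).finsupp (J.syz q)).obj s,
        IsCycle (K := fun n => (I.toProGroup.finsupp (I.syz 1)).finsupp (J.syz n))
          ((conjAction e e_map).finsupp (I.syz 1)).d w ∧
        (((ProAction.self I).d 0).finsupp (J.syz q)).app s w =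
          ((I.toProGroup.finsupp (I.syz 0)).finsupp (J.syz q)).map h z := by
  have hcol (i) (hi : i < q) (j) :
      ExactIn (K := fun i => (I.toProGroup.finsupp (I.syz j)).finsupp (J.syz i))
        ((conjAction e e_map).finsupp (I.syz j)).d i :=
    ProAction.exactIn_finsupp (exactIn_conjAction e e_map (hq i hi)) (I.syz j)
  obtain ⟨t, h, H⟩ := exists_lift_isCycle
    (D := fun i j => (I.toProGroup.finsupp (I.syz j)).finsupp (J.syz i))
    (fun i j => ((ProAction.self I).d j).finsupp (J.syz i))
    (fun j => ((conjAction e e_map).finsupp (I.syz j)).d)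
    (fun i j s x => (((conjAction e e_map).finsupp (I.syz (j + 1))).d_finsuppHom
      ((conjAction e e_map).finsupp (I.syz j)) i s
      (((ProAction.self I).d j).app s) (d_conjAction e e_map e_mul e_smul j s) x).symm)
    (fun i j s x => by
      refine (finsuppHom_finsuppHom _ _ _ _ x).trans (Finsupp.ext fun y => ?_)
      refine (finsuppHom_id_apply _ x y).trans ?_
      exact (ProAction.self I).d_d j s _)
    (fun j i s x => ((conjAction e e_map).finsupp (I.syz j)).d_d i s x)
    (fun i j => (hI j).finsupp (J.syz i)) q hcol q le_rfl 0 s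
  exact ⟨t, h, fun z hz => H z trivial hz⟩

/-- If the complexes `I_s ⊗ F_s` are pro-acyclic, then so are the corresponding complexes for a
pro-algebra over another ring that is anti-isomorphic to `{I_s}` as a pro-ring. -/
theorem ProNonUnitalAlgebra.IsAcyclic.transfer
    (e_map : ∀ {s t : S} (h : s ≤ t) x, e s (J.map h x) = I.map h (e t x)) (hI : I.IsAcyclic)
    (e_mul : ∀ s x y, e s (x * y) = e s y * e s x)
    (e_smul : ∀ s (c : k) (c' : k') x,
      c • e s (c' • x) = e s (c' • (e s).symm (c • e s x))) : J.IsAcyclic := by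
  intro q
  induction q using Nat.strong_induction_on with
  | h q ih =>
  intro s
  obtain ⟨t, h, H⟩ := exists_lift_finsupp e e_map hI e_mul e_smul ih s
  refine ⟨t, h, fun z hz => ?_⟩
  -- The generator `[1]` of `F_0` gives a section `x ↦ x · [1]` of the augmentation `I[k] → I`,
  -- which carries `z` into the double complex.
  let one (s : S) : (I.syz 0).obj s := show k from 1
  let f (s : S) : J.obj s →+ ((I.toProGroup.finsupp (I.syz 0)).obj s) :=
    (Finsupp.singleAddHom (one s)).comp (e s).toAddMonoidHom
  have hf (s : S) (b : Unitization k' (J.obj s)) (x : J.obj s) :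
      f s ((ProAction.self J).act s b x) =
        ((conjAction e e_map).finsupp (I.syz 0)).act s b (f s x) := by
    refine Eq.trans ?_ (finsuppHom_single id ((conjAction e e_map).act s b) (one s) (e s x)).symm
    exact congrArg (Finsupp.single (one s)) (conjAction_act e e_map s b x).symm
  obtain ⟨w, hw, hw'⟩ := H (finsuppHom id (f t) z)
    ((ProAction.self J).isCycle_finsuppHom ((conjAction e e_map).finsupp (I.syz 0)) t (f t) (hf t)
      z hz)
  let p (x : augSyz k (I.obj s) 1) : (I.toProGroup.finsupp (I.syz 1)).obj s →+ J.obj s :=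
    (e s).symm.toAddMonoidHom.comp (Finsupp.applyAddHom x)
  have hp (x : augSyz k (I.obj s) 1) (b : Unitization k' (J.obj s)) (v) :
      p x (((conjAction e e_map).finsupp (I.syz 1)).act s b v) =
        (ProAction.self J).act s b (p x v) := by
    refine (congrArg (e s).symm (finsuppHom_id_apply _ v x)).trans ((e s).injective ?_)
    refine ((e s).apply_symm_apply _).trans (Eq.trans ?_ (conjAction_act e e_map s b _))
    exact congrArg _ ((e s).apply_symm_apply _).symm
  -- The coefficient of `w` at each generator `x` of `F_1` is a cycle of `J ⊗ G`. The multiplier is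
  -- the element of `I` attached to `x` by `augSyzZeroHom_matrixHom_single`, moved to `J`, where it
  -- multiplies from the left.
  have hu (x : augSyz k (I.obj s) 1) := exists_d_eq_finsuppHom_mulLeft
    ((e s).symm (augLift k (I.obj s) (augMatrix k (I.obj s) 0 x)).snd) _
    (((conjAction e e_map).finsupp (I.syz 1)).isCycle_finsuppHom (ProAction.self J) s (p x) (hp x)
      w hw)
  choose u hu using hu
  obtain ⟨T, hT⟩ := exists_finset_sum_single (X := augSyz k (I.obj s) 1) (N := I.obj s) w
  let g : (I.toProGroup.finsupp (I.syz 0)).obj s →+ J.obj s :=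
    (e s).symm.toAddMonoidHom.comp (augSyzZeroHom k (I.obj s))
  let G : ((I.toProGroup.finsupp (I.syz 1)).finsupp (J.syz q)).obj s →+
      (J.toProGroup.finsupp (J.syz q)).obj s :=
    finsuppHom id (g.comp (((ProAction.self I).d 0).app s))
  -- `G` is the horizontal differential followed by the augmentation, and `w` lifts the image of `z
  -- · [1]`.
  have h1 : G w = (J.toProGroup.finsupp (J.syz q)).map h z := by
    refine (finsuppHom_finsuppHom id (((ProAction.self I).d 0).app s) id g w).symm.trans ?_
    refine (congrArg (finsuppHom id g) hw').trans ?_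
    refine (congrArg (finsuppHom id g) (finsuppHom_finsuppHom _ _ _ _ _)).trans
      ((finsuppHom_finsuppHom _ _ _ _ _).trans ?_)
    refine congrArg (fun φ => finsuppHom _ φ z) (AddMonoidHom.ext fun x => ?_)
    refine (congrArg g (finsuppHom_single _ _ (one t) (e t x))).trans ?_
    refine (congrArg (e s).symm (augSyzZeroHom_single _ _)).trans ?_
    refine (congrArg (e s).symm (one_smul k _)).trans ?_
    exact (congrArg (e s).symm (e_map h x).symm).trans ((e s).symm_apply_apply _)
  have h2 (x : augSyz k (I.obj s) 1) : ((ProAction.self J).d q).app s (u x) =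
      G (finsuppHom id (Finsupp.singleAddHom x) (finsuppHom id (Finsupp.applyAddHom x) w)) := by
    refine (hu x).trans ((finsuppHom_finsuppHom _ _ _ _ w).trans ?_)
    refine Eq.trans ?_ (congrArg G (finsuppHom_finsuppHom _ _ _ _ w)).symm
    refine Eq.trans ?_ (finsuppHom_finsuppHom _ _ _ _ w).symm
    refine congrArg (fun φ => finsuppHom _ φ w) (AddMonoidHom.ext fun v => ?_)
    refine (e s).injective ?_
    refine (e_mul s _ _).trans (Eq.trans ?_ ((e s).apply_symm_apply _).symm)
    refine Eq.trans ?_ (augSyzZeroHom_matrixHom_single x _).symm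
    exact congrArg₂ (fun x y : I.obj s => x * y) ((e s).apply_symm_apply _)
      ((e s).apply_symm_apply _)
  refine ⟨∑ x ∈ T, u x, (map_sum (((ProAction.self J).d q).app s) u T).trans ?_⟩
  refine (Finset.sum_congr rfl fun x _ => h2 x).trans ?_
  exact (map_sum G _ T).symm.trans ((congrArg G hT).trans h1)

end Transfer

/-! ### Change of base ring through the opposite algebra -/

/-- The opposite of a pro-non-unital algebra. -/
def ProNonUnitalAlgebra.op {k : Type u} [CommRing k] (I : ProNonUnitalAlgebra.{u, v} k S) :
    ProNonUnitalAlgebra.{u, v} k S where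
  obj s := (I.obj s)ᵐᵒᵖ
  map h :=
    { toFun := fun x => MulOpposite.op (I.map h x.unop)
      map_smul' := fun c x => by simp
      map_zero' := by simp
      map_add' := fun x y => by simp
      map_mul' := fun x y => by simp }
  map_refl s x := by simp [I.map_refl]
  map_trans hrs hst x := by simp [I.map_trans hrs hst]

/-- The first transfer changes both base ring and side; the second, over `k'` alone, restores the
side. The scalars commute since all act on `I` through the commutative ring `k`. -/
theorem ProNonUnitalAlgebra.IsAcyclic.restrictScalars {k k' : Type u} [CommRing k] [CommRing k']
    {I : ProNonUnitalAlgebra.{u, v} k S} (hI : I.IsAcyclic) (α : k' →+* k) :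
    (I.restrictScalars α).IsAcyclic := by
  let e (s : S) : (I.restrictScalars α).obj s ≃+ (I.restrictScalars α).op.obj s :=
    MulOpposite.opAddEquiv (α := I.obj s)
  have h : (I.restrictScalars α).op.IsAcyclic :=
    ProNonUnitalAlgebra.IsAcyclic.transfer (I := I) (J := (I.restrictScalars α).op)
      (fun s => (e s).symm) (fun _ _ => rfl) hI (fun _ _ _ => rfl)
      (fun s c c' x => smul_comm c (α c') (MulOpposite.unop x : I.obj s))
  exact ProNonUnitalAlgebra.IsAcyclic.transfer (I := (I.restrictScalars α).op)
    (J := I.restrictScalars α) e (fun _ _ => rfl) h (fun _ _ _ => rfl)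
    (fun s c c' x => congrArg MulOpposite.op (smul_comm (α c) (α c') (show I.obj s from x)))

/-! ### The maps on `Tor` in terms of the standard resolution -/

theorem exists_iCycles_eq {R : Type u} [Ring R] (K : ShortComplex (ModuleCat.{u} R)) (x : K.X₂)
    (hx : K.g.hom x = 0) : ∃ c, K.iCycles.hom c = x := by
  refine ⟨K.moduleCatCyclesIso.inv.hom ⟨x, hx⟩, ?_⟩
  exact congrArg (fun φ => φ.hom ⟨x, hx⟩) K.moduleCatCyclesIso_inv_iCycles

/-- The map on homology sits between the epimorphism from cycles and the monomorphism into opcycles,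
so its vanishing can be tested on elements. -/
theorem homologyMap_eq_zero_iff {R : Type u} [Ring R] {ι : Type*} {c : ComplexShape ι}
    {K L : HomologicalComplex (ModuleCat.{u} R) c} (φ : K ⟶ L) {i n j : ι} (hi : c.prev n = i)
    (hj : c.next n = j) :
    HomologicalComplex.homologyMap φ n = 0 ↔
      ∀ x, (K.d n j).hom x = 0 → ∃ y, (L.d i n).hom y = (φ.f n).hom x := by
  subst hi hj
  have h1 : HomologicalComplex.homologyMap φ n = 0 ↔
      K.iCycles n ≫ φ.f n ≫ L.pOpcycles n = 0 := by
    rw [← cancel_epi (K.homologyπ n), ← cancel_mono (L.homologyι n)]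
    simp
  rw [h1]
  constructor
  · intro h x hx
    obtain ⟨c, rfl⟩ := exists_iCycles_eq (K.sc n) x hx
    have := congrArg (fun φ => φ.hom c) h
    exact ((L.sc n).moduleCat_pOpcycles_eq_zero_iff _).1 this
  · intro h
    refine ModuleCat.hom_ext (LinearMap.ext fun c => ?_)
    refine ((L.sc n).moduleCat_pOpcycles_eq_zero_iff _).2 ?_
    refine h _ ?_
    exact congrArg (fun φ => φ.hom c) (K.sc n).iCycles_g

/-! ### The exact sequence `0 → I ⊗ F → F → k ⊗ F → 0` -/

section Level

variable {k : Type u} [CommRing k] {I : Type u} [NonUnitalRing I] [Module k I]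
  [IsScalarTower k I I] [SMulCommClass k I I]

variable (k I) in
/-- The reduction `(k ⋉ I)[X] → k ⊗ (k ⋉ I)[X]`. -/
def reduce (X : Type u) (v : X →₀ Unitization k I) :
    BalancedTensor k (Unitization k I) (AugModule k I) (X →₀ Unitization k I) :=
  Submodule.Quotient.mk ((show AugModule k I from (1 : k)) ⊗ₜ[ℤ] v)

theorem reduce_add (X : Type u) (v w : X →₀ Unitization k I) :
    reduce k I X (v + w) = reduce k I X v + reduce k I X w :=
  congrArg Submodule.Quotient.mk (TensorProduct.tmul_add _ v w)

theorem reduce_sub (X : Type u) (v w : X →₀ Unitization k I) :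
    reduce k I X (v - w) = reduce k I X v - reduce k I X w :=
  congrArg Submodule.Quotient.mk (TensorProduct.tmul_sub _ v w)

theorem mk_smul_tmul (X : Type u) (a : Unitization k I) (c : AugModule k I)
    (v : X →₀ Unitization k I) :
    (Submodule.Quotient.mk ((MulOpposite.op a • c) ⊗ₜ[ℤ] v) :
      BalancedTensor k (Unitization k I) (AugModule k I) (X →₀ Unitization k I)) =
      Submodule.Quotient.mk (c ⊗ₜ[ℤ] (a • v)) :=
  (Submodule.Quotient.eq _).2 (Submodule.subset_span ⟨c, a, v, rfl⟩)

theorem reduce_surjective (X : Type u) : Function.Surjective (reduce k I X) := by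
  intro t
  obtain ⟨t, rfl⟩ := Submodule.Quotient.mk_surjective _ t
  induction t using TensorProduct.induction_on with
  | zero => exact ⟨0, congrArg Submodule.Quotient.mk (TensorProduct.tmul_zero _ _)⟩
  | tmul c v =>
    refine ⟨(Unitization.inl (show k from c) : Unitization k I) • v,
      (mk_smul_tmul X _ _ v).symm.trans ?_⟩
    congr 2
    exact mul_one (M := k) _
  | add a b ha hb =>
    obtain ⟨v, hv⟩ := ha
    obtain ⟨w, hw⟩ := hb
    exact ⟨v + w, (reduce_add X v w).trans (congrArg₂ (· + ·) hv hw)⟩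

theorem reduce_finsuppInr (X : Type u) (v : X →₀ I) : reduce k I X (finsuppInr k I X v) = 0 := by
  induction v using Finsupp.induction_linear with
  | zero =>
    rw [map_zero]
    exact congrArg Submodule.Quotient.mk (TensorProduct.tmul_zero _ _)
  | add v w hv hw => rw [map_add, reduce_add, hv, hw, add_zero]
  | single x a =>
    have h : finsuppInr k I X (Finsupp.single x a) =
        (a : Unitization k I) • Finsupp.single x (1 : Unitization k I) := by
      rw [finsuppInr, finsuppHom_single, Finsupp.smul_single, smul_eq_mul, mul_one]
      rfl
    rw [h]
    refine (mk_smul_tmul X _ _ _).symm.trans ?_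
    have h0 : MulOpposite.op (a : Unitization k I) • (show AugModule k I from (1 : k)) = 0 :=
      zero_mul (M₀ := k) _
    rw [h0]
    exact congrArg Submodule.Quotient.mk (TensorProduct.zero_tmul _ _)

variable (k I) in
/-- The homomorphism `k ⊗ (k ⋉ I)[X] → k`, `c ⊗ v ↦ c · fst (v x)`. -/
def reduceCoeff (X : Type u) (x : X) :
    BalancedTensor k (Unitization k I) (AugModule k I) (X →₀ Unitization k I) →ₗ[k] k :=
  Submodule.liftQ _
    (TensorProduct.AlgebraTensorModule.lift
      { toFun := fun c : AugModule k I => AddMonoidHom.toIntLinearMap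
          ((AddMonoidHom.mulLeft (show k from c)).comp
            ((aug k I : Unitization k I →+ k).comp (Finsupp.applyAddHom x)))
        map_add' := fun c c' => LinearMap.ext fun v => add_mul (R := k) _ _ _
        map_smul' := fun c c' => LinearMap.ext fun v => mul_assoc (G := k) _ _ _ }) <| by
    rw [balancedRel, Submodule.span_le]
    rintro _ ⟨c, a, v, rfl⟩
    refine (map_sub _ _ _).trans (sub_eq_zero.2 ?_)
    change (aug k I a * (show k from c)) * aug k I (v x) =
      (show k from c) * aug k I (a * v x)
    rw [map_mul]
    ring

/-- Exactness in the middle: `reduceCoeff` detects the scalar part of each coordinate, and vectors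
without scalar part come from `I[X]`. -/
theorem reduce_eq_zero_iff {X : Type u} (v : X →₀ Unitization k I) :
    reduce k I X v = 0 ↔ ∃ w, finsuppInr k I X w = v := by
  constructor
  · intro h
    refine exists_finsuppInr_eq v fun x => ?_
    exact (one_mul (M := k) _).symm.trans ((congrArg (reduceCoeff k I X x) h).trans (map_zero _))
  · rintro ⟨w, rfl⟩
    exact reduce_finsuppInr X w

variable {J : Type u} [NonUnitalRing J] [Module k J] [IsScalarTower k J J] [SMulCommClass k J J]

theorem torComplex_d_reduce (n : ℕ) (v : augSyz k I (n + 1) →₀ Unitization k I) :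
    ((torComplex k (Unitization k I) (AugModule k I) (augCat k I)).d (n + 1) n).hom
      (reduce k I _ v) = reduce k I _ (stdD _ (augCat k I) n v) := by
  rw [torComplex_d]
  rfl

/-- As `reduce` is surjective, chains of `k ⊗ F` can be replaced by representatives in `F`, where
the connecting map is computed. -/
theorem augTorMap_eq_zero_iff (f : I →ₙₐ[k] J) (n : ℕ) :
    augTorMap f (n + 1) = 0 ↔
      ∀ v : augSyz k I (n + 1) →₀ Unitization k I,
        reduce k I _ (stdD _ (augCat k I) n v) = 0 →
          ∃ w : augSyz k J (n + 1 + 1) →₀ Unitization k J,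
            reduce k J _ (stdD _ (augCat k J) (n + 1) w) =
              reduce k J _ (freeMap (unitizationMap f)
                (syzMap (unitizationMap f) (augLeft f) (n + 1)) v) := by
  have h0 : augTorMap f (n + 1) = 0 ↔ HomologicalComplex.homologyMap
      (torComplexMap (M := augCat k I) (N := augCat k J) (unitizationMap f) (augRight k I J)
        (augRight_smul f) (augLeft f)) (n + 1) = 0 := by
    unfold augTorMap torMap
    simp
  rw [h0, homologyMap_eq_zero_iff _ (ChainComplex.prev ℕ (n + 1)) (ChainComplex.next_nat_succ n)]
  constructor
  · intro h v hv
    obtain ⟨y, hy⟩ := h (reduce k I _ v) ((torComplex_d_reduce n v).trans hv)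
    obtain ⟨w, rfl⟩ := reduce_surjective _ y
    exact ⟨w, (torComplex_d_reduce (n + 1) w).symm.trans hy⟩
  · intro h x hx
    obtain ⟨v, rfl⟩ := reduce_surjective _ x
    obtain ⟨w, hw⟩ := h v ((torComplex_d_reduce n v).symm.trans hx)
    exact ⟨reduce k J _ w, (torComplex_d_reduce (n + 1) w).trans hw⟩

end Level

/-! ### Pro-vanishing of `Tor` in degree `n + 1` and pro-exactness of `I ⊗ F` in degree `n` -/

section

variable {k : Type u} [CommRing k] {I : ProNonUnitalAlgebra.{u, v} k S}

/-- Inverts the connecting map: a cycle `v` of `I ⊗ F` bounds some `u` in `F`, whose reduction is a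
cycle. At the lower level this reduction bounds, so the image of `u` differs from a boundary `d y`
by some `w` in `I ⊗ F`, and `d w` is the image of `v`. -/
theorem exactIn_of_isProZero {n : ℕ} (h : IsProZero (proTor I (n + 1))) :
    ExactIn (K := fun n => I.toProGroup.finsupp (I.syz n)) (ProAction.self I).d n := by
  intro s
  obtain ⟨t, hst, H⟩ := h s
  refine ⟨t, hst, fun v hv => ?_⟩
  have H' := (augTorMap_eq_zero_iff (I.map hst) n).1 H
  obtain ⟨u, hu⟩ := exists_stdD_eq_finsuppInr v hv
  obtain ⟨y, hy⟩ := H' u (by rw [hu]; exact reduce_finsuppInr _ _)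
  obtain ⟨w, hw⟩ := (reduce_eq_zero_iff _).1 ((reduce_sub _ _ _).trans (sub_eq_zero.2 hy.symm))
  refine ⟨w, finsuppInr_injective (k := k) (I := I.obj s) ?_⟩
  refine (stdD_finsuppInr n w).symm.trans ?_
  rw [hw, map_sub, (stdD_eq_zero_iff _ _ n _).2 (freeCounit_stdD _ _ (n + 1) y), sub_zero,
    stdD_freeMap, hu]
  exact freeMap_finsuppInr (I.map hst) _ v

theorem isProZero_of_exactIn {n : ℕ}
    (h : ExactIn (K := fun n => I.toProGroup.finsupp (I.syz n)) (ProAction.self I).d n) :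
    IsProZero (proTor I (n + 1)) := by
  intro s
  obtain ⟨t, hst, H⟩ := h s
  refine ⟨t, hst, (augTorMap_eq_zero_iff (I.map hst) n).2 fun v hv => ?_⟩
  obtain ⟨x, hx⟩ := (reduce_eq_zero_iff _).1 hv
  obtain ⟨w, hw⟩ := H x (by
    cases n with
    | zero => trivial
    | succ n =>
      refine finsuppInr_injective (k := k) (I := I.obj t) ?_
      refine (stdD_finsuppInr n x).symm.trans ?_
      rw [hx, (stdD_eq_zero_iff _ _ n _).2 (freeCounit_stdD _ _ (n + 1) v)]
      exact (map_zero _).symm)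
  -- The boundary of `v` comes from `x` in `I ⊗ F`, and `w` has the image of `x` as boundary.
  -- Subtracting `w` makes the image of `v` a cycle of `F`, hence a boundary, without altering its
  -- reduction.
  have hc : stdD _ (augCat k (I.obj s)) n (freeMap (unitizationMap (I.map hst))
      (syzMap (unitizationMap (I.map hst)) (augLeft (I.map hst)) (n + 1)) v -
        finsuppInr k (I.obj s) (augSyz k (I.obj s) (n + 1)) w) = 0 := by
    rw [map_sub, stdD_freeMap, ← hx, sub_eq_zero]
    refine (freeMap_finsuppInr (I.map hst) _ x).trans (Eq.trans ?_ (stdD_finsuppInr n w).symm)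
    exact congrArg (finsuppInr k (I.obj s) _) hw.symm
  obtain ⟨u, hu⟩ := exact_freeCounit _ _ (n + 1) _ ((stdD_eq_zero_iff _ _ n _).1 hc)
  refine ⟨u, ?_⟩
  rw [hu]
  refine (reduce_sub _ _ _).trans ((congrArg _ (reduce_finsuppInr (I := I.obj s) _ w)).trans (sub_zero _))

end

end ProTor

end

theorem mainTheorem8 {k k' : Type u} [CommRing k] [CommRing k'] (α : k' →+* k)
    {S : Type v} [PartialOrder S] [IsDirectedOrder S] (I : ProTor.ProNonUnitalAlgebra.{u, v} k S)
    (h : ∀ q : ℕ, 0 < q → ProTor.IsProZero (ProTor.proTor I q)) :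
    ∀ q : ℕ, 0 < q → ProTor.IsProZero (ProTor.proTor (I.restrictScalars α) q) := by
  have hI : I.IsAcyclic := fun n => ProTor.exactIn_of_isProZero (h (n + 1) n.succ_pos)
  intro q hq
  obtain ⟨n, rfl⟩ := Nat.exists_eq_succ_of_ne_zero hq.ne'
  exact ProTor.isProZero_of_exactIn (hI.restrictScalars α n)
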